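/- Let $n\ge 2$, $m\ge 1$, let $\Omega\subset\mathbb{R}^n$ be a bounded domain with smooth boundary, $T_0>0$, $Q=\Omega\times(0,T_0)$, $U_0\in L^2(\Omega,\mathbb{R}^m)$, and let $A:\mathbb{R}^m\times\mathbb{R}^{mn}\to\mathbb{R}^{mn}$ and $F:\mathbb{R}^m\times\mathbb{R}^{mn}\to\mathbb{R}^m$ be maps such that: A.1) there is $\lambda_0>0$ such that for all $u\in\mathbb{R}^m$ and $\zeta_1,\zeta_2\in\mathbb{R}^{mn}$, $$\lambda_0|\zeta_1-\zeta_2|^2\le\langle A(u,\zeta_1)-A(u,\zeta_2),\zeta_1-\zeta_2\rangle;$$ A.2) there is a continuous function $C:\mathbb{R}^m\times\mathbb{R}^m\to\mathbb{R}$ such that for all $u_1,u_2\in\mathbb{R}^m$ and $\zeta_1,\zeta_2\in\mathbb{R}^{mn}$, $$|A(u_1,\zeta_1)-A(u_2,\zeta_1)|\le C(u_1,u_2)|u_1-u_2||\zeta_1|,$$ $$|F(u_1,\zeta_1)-F(u_2,\zeta_2)|\le C(u_1,u_2)\bigl(|u_1-u_2||\zeta_2|+|\zeta_1-\zeta_2|\bigr).$$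 Consider the system $$u_t=\operatorname{div}A(u,Du)+F(u,Du)\ \text{ in }Q,\qquad u(\cdot,0)=U_0\ \text{ in }\Omega,\qquad (*)$$ with either the homogeneous Dirichlet or the homogeneous Neumann (no-flux) condition on $\partial\Omega\times(0,T_0)$. Let $V=W^{1,2}_0(\Omega,\mathbb{R}^m)$ in the Dirichlet case and $V=W^{1,2}(\Omega,\mathbb{R}^m)$ in the Neumann case. A weak solution of $(*)$ on $Q$ is a function $u\in L^2(0,T_0;V)$ with $A(u,Du),F(u,Du)\in L^2(Q)$ such that, for all $v\in V$ and all $\theta\in C_c^\infty((-\infty,T_0))$, $$-\int_0^{T_0}\theta'\int_\Omega\langle u,v\rangle\,dx\,dt+\int_0^{T_0}\theta\int_\Omega\langle A(u,Du),Dv\rangle\,dx\,dt=\theta(0)\int_\Omega\langle U_0,v\rangle\,dx+\int_0^{T_0}\theta\int_\Omega\langle F(u,Du),v\rangle\,dx\,dt.$$ Suppose that there are constants $C^*$ and $p>n/2$ such that every weak solution $u$ of $(*)$ on $Q$ satisfies $$\operatorname*{ess\,sup}_{t\in(0,T_0)}\int_\Omega|Du(x,t)|^{2p}\,dx\le C^*.$$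 Then $(*)$ has at most one weak solution on $Q$: any two weak solutions agree almost everywhere on $Q$. -/

import Mathlib

open MeasureTheory Set Filter Topology
open scoped ContDiff InnerProductSpace ENNReal

noncomputable section

/-- `ℝ^d` with its Euclidean norm. -/
abbrev Vec (d : ℕ) : Type := EuclideanSpace ℝ (Fin d)

/-- `ℝ^{mn}` with its Euclidean (Frobenius) inner product. For the gradient `Du` of
`u : ℝ^n → ℝ^m`, the entry at `(k, i)` is `∂_i u_k`. -/
abbrev Mat (m n : ℕ) : Type := EuclideanSpace ℝ (Fin m × Fin n)

/-- A bounded domain (nonempty connected open set) with smooth boundary: near each boundary point,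
in a suitably rotated orthonormal coordinate system, `Ω` is the region strictly above the graph of
a smooth function `γ` of the coordinates orthogonal to the unit vector `e`. -/
structure IsBoundedSmoothDomain {n : ℕ} (Ω : Set (Vec n)) : Prop where
  isOpen : IsOpen Ω
  isConnected : IsConnected Ω
  isBounded : Bornology.IsBounded Ω
  smooth_boundary : ∀ x₀ ∈ frontier Ω, ∃ e : Vec n, ‖e‖ = 1 ∧ ∃ r > (0 : ℝ),
    ∃ γ : Vec n → ℝ, ContDiff ℝ ∞ γ ∧ (∀ (x : Vec n) (s : ℝ), γ (x + s • e) = γ x) ∧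
      ∀ x ∈ Metric.ball x₀ r, (x ∈ Ω ↔ γ x < ⟪x, e⟫_ℝ)

/-- Smooth functions with compact support in `Ω`. -/
def IsTestFunction {n : ℕ} {G : Type*} [NormedAddCommGroup G] [NormedSpace ℝ G]
    (Ω : Set (Vec n)) (φ : Vec n → G) : Prop :=
  ContDiff ℝ ∞ φ ∧ HasCompactSupport φ ∧ tsupport φ ⊆ Ω

/-- The classical partial derivative `∂_i φ`. -/
def partialDeriv {n : ℕ} {G : Type*} [NormedAddCommGroup G] [NormedSpace ℝ G]
    (i : Fin n) (φ : Vec n → G) (x : Vec n) : G :=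
  fderiv ℝ φ x (EuclideanSpace.single i 1)

/-- The classical gradient of `φ : ℝ^n → ℝ^m`. -/
def gradMat {m n : ℕ} (φ : Vec n → Vec m) (x : Vec n) : Mat m n :=
  WithLp.toLp 2 fun ki => partialDeriv ki.2 φ x ki.1

/-- `v ∈ W^{1,2}(Ω, ℝ^m)` with weak gradient `Dv`. -/
structure MemW12 {m n : ℕ} (Ω : Set (Vec n)) (v : Vec n → Vec m) (Dv : Vec n → Mat m n) :
    Prop where
  memLp : MemLp v 2 (volume.restrict Ω)
  memLp_grad : MemLp Dv 2 (volume.restrict Ω)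
  weak_grad : ∀ φ : Vec n → ℝ, IsTestFunction Ω φ → ∀ (k : Fin m) (i : Fin n),
    ∫ x in Ω, v x k * partialDeriv i φ x = - ∫ x in Ω, Dv x (k, i) * φ x

/-- `v ∈ W_0^{1,2}(Ω, ℝ^m)` with weak gradient `Dv`: `v` is a limit in `W^{1,2}(Ω, ℝ^m)` of smooth
functions with compact support in `Ω`. -/
structure MemW12Zero {m n : ℕ} (Ω : Set (Vec n)) (v : Vec n → Vec m) (Dv : Vec n → Mat m n) :
    Prop extends MemW12 Ω v Dv where
  approx : ∃ φ : ℕ → Vec n → Vec m, (∀ j, IsTestFunction Ω (φ j)) ∧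
    Tendsto (fun j => eLpNorm (fun x => φ j x - v x) 2 (volume.restrict Ω)) atTop (𝓝 0) ∧
    Tendsto (fun j => eLpNorm (fun x => gradMat (φ j) x - Dv x) 2 (volume.restrict Ω)) atTop (𝓝 0)

/-- The two kinds of homogeneous boundary condition on `∂Ω × (0, T₀)`. -/
inductive BoundaryCondition
  | dirichlet
  | neumann

/-- The energy space of the boundary condition: `W_0^{1,2}(Ω, ℝ^m)` for the Dirichlet condition,
`W^{1,2}(Ω, ℝ^m)` for the Neumann condition (which is the natural one of the weak formulation). -/
def MemEnergySpace {m n : ℕ} (bc : BoundaryCondition) (Ω : Set (Vec n))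
    (v : Vec n → Vec m) (Dv : Vec n → Mat m n) : Prop :=
  match bc with
  | .dirichlet => MemW12Zero Ω v Dv
  | .neumann => MemW12 Ω v Dv

/-- Lebesgue measure on the cylinder `Q = Ω × (0, T₀)`; the time variable comes first. -/
def cylinderMeasure {n : ℕ} (Ω : Set (Vec n)) (T₀ : ℝ) : Measure (ℝ × Vec n) :=
  (volume.restrict (Ioo 0 T₀)).prod (volume.restrict Ω)

/-- `u`, with spatial weak gradient `Du`, is a weak solution on `Q = Ω × (0, T₀)` of
`u_t = div A(u, Du) + F(u, Du)`, `u(·, 0) = U₀`, with the boundary condition `bc`: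
`u` lies in `L²(0, T₀; V)`, `V` being the energy space of `bc`, the terms `A(u, Du)` and `F(u, Du)`
are square integrable on `Q`, and the equation and the initial condition hold when tested with
`θ(t) v(x)` for all `v ∈ V` and all smooth `θ` with compact support in `(-∞, T₀)`. -/
structure IsWeakSolution {m n : ℕ} (A : Vec m → Mat m n → Mat m n) (F : Vec m → Mat m n → Vec m)
    (bc : BoundaryCondition) (Ω : Set (Vec n)) (T₀ : ℝ) (U₀ : Vec n → Vec m)
    (u : ℝ → Vec n → Vec m) (Du : ℝ → Vec n → Mat m n) : Prop where
  memLp : MemLp (fun z : ℝ × Vec n => u z.1 z.2) 2 (cylinderMeasure Ω T₀)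
  memLp_grad : MemLp (fun z : ℝ × Vec n => Du z.1 z.2) 2 (cylinderMeasure Ω T₀)
  mem_energySpace : ∀ᵐ t ∂(volume.restrict (Ioo 0 T₀)), MemEnergySpace bc Ω (u t) (Du t)
  memLp_flux : MemLp (fun z : ℝ × Vec n => A (u z.1 z.2) (Du z.1 z.2)) 2 (cylinderMeasure Ω T₀)
  memLp_reaction :
    MemLp (fun z : ℝ × Vec n => F (u z.1 z.2) (Du z.1 z.2)) 2 (cylinderMeasure Ω T₀)
  weak_form : ∀ (v : Vec n → Vec m) (Dv : Vec n → Mat m n), MemEnergySpace bc Ω v Dv →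
    ∀ θ : ℝ → ℝ, ContDiff ℝ ∞ θ → HasCompactSupport θ → tsupport θ ⊆ Iio T₀ →
      - (∫ t in Ioo 0 T₀, deriv θ t * ∫ x in Ω, ⟪u t x, v x⟫_ℝ)
          + ∫ t in Ioo 0 T₀, θ t * ∫ x in Ω, ⟪A (u t x) (Du t x), Dv x⟫_ℝ
        = θ 0 * (∫ x in Ω, ⟪U₀ x, v x⟫_ℝ)
          + ∫ t in Ioo 0 T₀, θ t * ∫ x in Ω, ⟪F (u t x) (Du t x), v x⟫_ℝ

/-- Monotonicity condition on `A`. -/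
def MonotonicityCondition {m n : ℕ} (A : Vec m → Mat m n → Mat m n) : Prop :=
  ∃ lam₀ > (0 : ℝ), ∀ (u : Vec m) (ζ₁ ζ₂ : Mat m n),
    lam₀ * ‖ζ₁ - ζ₂‖ ^ 2 ≤ ⟪A u ζ₁ - A u ζ₂, ζ₁ - ζ₂⟫_ℝ

/-- Lipschitz condition on `A` and `F`. -/
def LipschitzCondition {m n : ℕ} (A : Vec m → Mat m n → Mat m n)
    (F : Vec m → Mat m n → Vec m) : Prop :=
  ∃ C : Vec m × Vec m → ℝ, Continuous C ∧ ∀ (u₁ u₂ : Vec m) (ζ₁ ζ₂ : Mat m n),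
    ‖A u₁ ζ₁ - A u₂ ζ₁‖ ≤ C (u₁, u₂) * ‖u₁ - u₂‖ * ‖ζ₁‖ ∧
    ‖F u₁ ζ₁ - F u₂ ζ₂‖ ≤ C (u₁, u₂) * (‖u₁ - u₂‖ * ‖ζ₂‖ + ‖ζ₁ - ζ₂‖)

end

/-! Let `w` be the difference of two solutions. Formally, testing its equation with `w` itself gives
`½ d/dt ∫|w|² = ∫⟨F₁ - F₂, w⟩ - ∫⟨A₁ - A₂, Dw⟩`. Inserting `A(u₁, Du₂)` and using monotonicity, the
Lipschitz condition and Young's inequality, the right side is at most `-(λ/2)∫|Dw|² + c ∫|Du₂|²|w|²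
+ c ∫|w|²`, provided `C(u₁, u₂)` is bounded. If the weighted term is absorbed into the gradient
term, Gronwall's inequality with zero initial value gives `w = 0`. The assumed gradient bound enters
twice, both times through `p > n/2`.

Boundedness of `C(u₁, u₂)`: since `2p > n`, Morrey's estimate
(`IsBoundedSmoothDomain.exists_sup_bound`) bounds each solution, once `∫|u|²` is bounded uniformly
in time (`IsWeakSolution.exists_energy_bound`).

Absorption: the weight `|Du₂|²` is bounded in `L^p`, so `∫|Du₂|²|w|² ≤ ε ∫|Dw|² + C ∫|w|²` for every
`ε > 0` (`IsBoundedSmoothDomain.exists_weighted_bound`). Both space estimates come from one source: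
bound `w(x)` by `w(x + z)` and an integral of the gradient along the segment, then average over `z`
in a small set provided by a local cone property of the smooth domain.

The formal testing is justified in `energy_identity`. Only products `θ(t) v(x)` are admissible, so
`v = w(s)` is used for frozen `s`, with `θ` a mollifier centred at `s`, and the result is integrated
in `s`. The term with the derivative of the mollifier is antisymmetric in the two times and vanishes
before any limit is taken. No time derivative of `w` and no continuity in time is needed. The common
initial datum cancels in the difference, so cutoffs need not vanish at `t = 0`; this is how the zero
initial value enters the Gronwall argument `ae_eq_zero_of_energy_inequality`. -/

/-! ### Square integrable functions on a product as curves in `L²` -/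

/-- A map into a second countable metric space is measurable when its distances to all points are. -/
theorem measurable_of_measurable_dist {α β : Type*} [MeasurableSpace α] [PseudoMetricSpace β]
    [SecondCountableTopology β] [MeasurableSpace β] [BorelSpace β] {f : α → β}
    (hf : ∀ y, Measurable fun a => dist (f a) y) : Measurable f := by
  refine measurable_of_isOpen fun U hU => ?_
  choose! r hr0 hr using fun x (hx : x ∈ U) => Metric.isOpen_iff.1 hU x hx
  -- Lindelöf: countably many balls suffice, and the preimage of a ball is a sublevel set of a
  -- distance function.
  obtain ⟨T, hTc, hT⟩ := TopologicalSpace.isOpen_iUnion_countable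
    (fun x : U => Metric.ball (x : β) (r x)) (fun _ => Metric.isOpen_ball)
  have hUeq : U = ⋃ x ∈ T, Metric.ball (x : β) (r x) := by
    rw [hT]
    refine subset_antisymm (fun x hx => mem_iUnion.2 ⟨⟨x, hx⟩, ?_⟩) (iUnion_subset fun x => hr x x.2)
    exact Metric.mem_ball_self (hr0 x hx)
  rw [hUeq, preimage_iUnion₂]
  exact MeasurableSet.biUnion hTc fun x _ => measurableSet_lt (hf x) measurable_const

/-- A function in `L²` of a product is a curve in `L²` of the second factor. -/
theorem exists_memLp_curve {X Y E : Type*} [MeasurableSpace X] [MeasurableSpace Y]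
    [NormedAddCommGroup E] [SecondCountableTopology E] [CompleteSpace E]
    {μ : Measure X} {ν : Measure Y} [SFinite μ] [SFinite ν] [IsSeparable ν]
    {G : X → Y → E}
    (hG : MemLp (fun z : X × Y => G z.1 z.2) 2 (μ.prod ν)) :
    ∃ W : X → Lp E 2 ν, MemLp W 2 μ ∧ ∀ᵐ t ∂μ, W t =ᵐ[ν] G t := by
  classical
  borelize E
  obtain ⟨H, hHm, hGH⟩ := hG.1
  have hH : MemLp H 2 (μ.prod ν) := hG.ae_eq hGH
  have hint : ∫⁻ z, ‖H z‖ₑ ^ (2 : ℝ) ∂(μ.prod ν) < ⊤ := by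
    have := (eLpNorm_lt_top_iff_lintegral_rpow_enorm_lt_top (by simp) (by simp)).1 hH.2
    simpa using this
  have hmeas : Measurable fun z => ‖H z‖ₑ ^ (2 : ℝ) := hHm.measurable.enorm.pow_const _
  have hsec : ∀ t, StronglyMeasurable fun x => H (t, x) := fun t =>
    hHm.comp_measurable measurable_prodMk_left
  have hMem : ∀ t, MemLp (fun x => H (t, x)) 2 ν ↔ ∫⁻ x, ‖H (t, x)‖ₑ ^ (2 : ℝ) ∂ν < ⊤ := by
    intro t
    have := eLpNorm_lt_top_iff_lintegral_rpow_enorm_lt_top (μ := ν) (f := fun x => H (t, x))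
      (p := 2) (by simp) (by simp)
    simp only [ENNReal.toReal_ofNat] at this
    exact ⟨fun h => this.1 h.2, fun h => ⟨(hsec t).aestronglyMeasurable, this.2 h⟩⟩
  let W : X → Lp E 2 ν := fun t =>
    if h : MemLp (fun x => H (t, x)) 2 ν then h.toLp _ else 0
  have hset : MeasurableSet {t | MemLp (fun x => H (t, x)) 2 ν} := by
    simp only [hMem]
    exact measurableSet_lt hmeas.lintegral_prod_right' measurable_const
  have hWae : ∀ᵐ t ∂μ, MemLp (fun x => H (t, x)) 2 ν := by
    rw [lintegral_prod _ hmeas.aemeasurable] at hint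
    filter_upwards [ae_lt_top hmeas.lintegral_prod_right' hint.ne] with t ht
    exact (hMem t).2 ht
  borelize ↥(Lp E 2 ν)
  have : Fact ((2 : ℝ≥0∞) ≠ ⊤) := ⟨by simp⟩
  -- Separability of `ν` and of `E` makes `L²` second countable, so distances to fixed points decide
  -- measurability. Each distance is a parameter integral, measurable by Tonelli; the value `0` of
  -- `W` at bad times is harmless since these form a measurable null set.
  have hdist : ∀ y, Measurable fun t => dist (W t) y := by
    intro y
    have hm : Measurable fun t => (∫⁻ x, ‖H (t, x) - y x‖ₑ ^ (2 : ℝ) ∂ν) ^ (1 / (2 : ℝ)) := by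
      refine Measurable.pow_const ?_ _
      refine Measurable.lintegral_prod_right' (f := fun z : X × Y => ‖H z - y z.2‖ₑ ^ (2 : ℝ)) ?_
      exact ((hHm.sub ((Lp.stronglyMeasurable y).comp_measurable measurable_snd)).measurable.enorm).pow_const _
    have : (fun t => dist (W t) y) = fun t => if MemLp (fun x => H (t, x)) 2 ν then
        ((∫⁻ x, ‖H (t, x) - y x‖ₑ ^ (2 : ℝ) ∂ν) ^ (1 / (2 : ℝ))).toReal else dist 0 y := by
      funext t
      by_cases h : MemLp (fun x => H (t, x)) 2 ν
      · simp only [W, h, dite_true, if_true]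
        rw [Lp.dist_def, eLpNorm_eq_lintegral_rpow_enorm_toReal (by simp) (by simp)]
        simp only [ENNReal.toReal_ofNat]
        congr 2
        refine lintegral_congr_ae ?_
        filter_upwards [h.coeFn_toLp] with x hx
        simp [hx]
      · simp only [W, h, dite_false, if_false]
    rw [this]
    exact Measurable.ite hset hm.ennreal_toReal measurable_const
  have hWm : Measurable W := measurable_of_measurable_dist hdist
  have hWn : ∀ t, ‖W t‖ₑ ^ (2 : ℝ) ≤ ∫⁻ x, ‖H (t, x)‖ₑ ^ (2 : ℝ) ∂ν := by
    intro t
    by_cases h : MemLp (fun x => H (t, x)) 2 ν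
    · simp only [W, h, dite_true]
      rw [Lp.enorm_def, eLpNorm_congr_ae h.coeFn_toLp,
        eLpNorm_eq_lintegral_rpow_enorm_toReal (by simp) (by simp)]
      simp only [ENNReal.toReal_ofNat]
      rw [← ENNReal.rpow_mul]; norm_num
    · simp [W, h]
  refine ⟨W, ⟨hWm.stronglyMeasurable.aestronglyMeasurable, ?_⟩, ?_⟩
  · rw [eLpNorm_lt_top_iff_lintegral_rpow_enorm_lt_top (by simp) (by simp)]
    simp only [ENNReal.toReal_ofNat]
    refine (lintegral_mono hWn).trans_lt ?_
    rwa [lintegral_prod _ hmeas.aemeasurable] at hint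
  · filter_upwards [hWae, Measure.ae_ae_of_ae_prod hGH] with t ht hGt
    simp only [W, ht, dite_true]
    filter_upwards [ht.coeFn_toLp, hGt] with x hx hx'
    rw [hx]; exact hx'.symm

/-! ### Correlations of `L²` curves and mollification in two time variables -/

section Mollification

open scoped Convolution

variable {H : Type*} [NormedAddCommGroup H] [InnerProductSpace ℝ H]

/-- The correlation of two square integrable curves is continuous. -/
theorem continuous_integral_inner_translate [CompleteSpace H] {f g : ℝ → H}
    (hf : MemLp f 2 volume) (hg : MemLp g 2 volume) :
    Continuous fun z : ℝ => ∫ t, ⟪f t, g (z + t)⟫_ℝ := by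
  have : Fact ((2 : ℝ≥0∞) ≠ ⊤) := ⟨by simp⟩
  -- The correlation is an `L²` inner product with a translate, and translations act continuously on
  -- `L²`.
  have hc : Continuous fun z : ℝ => ⟪hf.toLp f, DomAddAct.mk z +ᵥ hg.toLp g⟫_ℝ :=
    continuous_const.inner (DomAddAct.continuous_mk.vadd continuous_const)
  convert! hc using 2 with z
  rw [DomAddAct.mk_vadd_toLp, L2.inner_def]
  refine integral_congr_ae ?_
  filter_upwards [hf.coeFn_toLp, MemLp.coeFn_toLp
    (hg.comp_measurePreserving (measurePreserving_vadd z volume))] with t h1 h2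
  rw [h1]; exact congrArg _ h2.symm

theorem integrable_kernel_mul_inner {f g : ℝ → H} (hf : Integrable f) (hg : Integrable g)
    {k : ℝ × ℝ → ℝ} (hk : Continuous k) {M : ℝ} (hM : ∀ z, |k z| ≤ M) :
    Integrable (fun z : ℝ × ℝ => k z * ⟪f z.1, g z.2⟫_ℝ) (volume.prod volume) := by
  refine Integrable.mono' ((hf.norm.mul_prod hg.norm).const_mul M)
    (hk.aestronglyMeasurable.mul (hf.1.comp_fst.inner hg.1.comp_snd)) (ae_of_all _ fun z => ?_)
  rw [norm_mul, Real.norm_eq_abs]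
  exact mul_le_mul (hM z) (norm_inner_le_norm _ _) (norm_nonneg _) ((abs_nonneg _).trans (hM z))

/-- The substitution `s = t + z` and evenness of the mollifier turn the double integral into the
mollification at `0` of the correlation `z ↦ ∫⟨f(t), g(t + z)⟩`. That function is continuous even
though `f` and `g` are not, so its mollifications converge to its value at `0`. -/
theorem tendsto_integral_mollifier_inner [CompleteSpace H] {ι : Type*} {l : Filter ι}
    {φ : ι → ContDiffBump (0 : ℝ)} (hφ : Tendsto (fun i => (φ i).rOut) l (𝓝 0)) {f g : ℝ → H}
    (hf : Integrable f) (hg : Integrable g) (hf2 : MemLp f 2 volume) (hg2 : MemLp g 2 volume) :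
    Tendsto (fun i => ∫ z : ℝ × ℝ, (φ i).normed volume (z.2 - z.1) * ⟪f z.1, g z.2⟫_ℝ)
      l (𝓝 (∫ t, ⟪f t, g t⟫_ℝ)) := by
  set c : ℝ → ℝ := fun z => ∫ t, ⟪f t, g (z + t)⟫_ℝ with hc
  have hcc : Continuous c := continuous_integral_inner_translate hf2 hg2
  have h1 := ContDiffBump.convolution_tendsto_right_of_continuous (μ := volume) hφ hcc 0
  have h0 : c 0 = ∫ t, ⟪f t, g t⟫_ℝ := by simp [hc]
  rw [h0] at h1
  refine h1.congr fun i => ?_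
  set ρ := (φ i).normed volume with hρ
  obtain ⟨M, hM⟩ := (φ i).hasCompactSupport_normed (μ := volume).exists_bound_of_continuous
    (φ i).continuous_normed
  have hint := integrable_kernel_mul_inner hf hg (k := fun z => ρ (z.2 - z.1))
    ((φ i).continuous_normed.comp (continuous_snd.sub continuous_fst)) (fun z => hM _)
  have hmp := measurePreserving_prod_add (volume : Measure ℝ) (volume : Measure ℝ)
  have hint2 : Integrable (fun z : ℝ × ℝ => ρ z.2 * ⟪f z.1, g (z.1 + z.2)⟫_ℝ)
      (volume.prod volume) := by
    have := hmp.integrable_comp_of_integrable hint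
    refine this.congr (ae_of_all _ fun z => ?_)
    simp [Function.comp]
  calc (ρ ⋆[ContinuousLinearMap.lsmul ℝ ℝ, volume] c) 0
      = ∫ z, ρ z * c (-z) := by simp [convolution_def]
    _ = ∫ z, ρ z * c z := by
        rw [← integral_neg_eq_self]
        simp [hρ, ContDiffBump.normed_neg]
    _ = ∫ z, ∫ t, ρ z * ⟪f t, g (t + z)⟫_ℝ := by
        refine integral_congr_ae (ae_of_all _ fun z => ?_)
        simp only [hc]
        rw [← integral_const_mul]
        simp [add_comm]
    _ = ∫ t, ∫ z, ρ z * ⟪f t, g (t + z)⟫_ℝ := (integral_integral_swap (f := fun t z =>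
        ρ z * ⟪f t, g (t + z)⟫_ℝ) hint2).symm
    _ = ∫ t, ∫ s, ρ (s - t) * ⟪f t, g s⟫_ℝ := by
        refine integral_congr_ae (ae_of_all _ fun t => ?_)
        simp only
        rw [← integral_sub_right_eq_self (μ := volume) (fun z => ρ z * ⟪f t, g (t + z)⟫_ℝ) t]
        simp
    _ = _ := (integral_prod _ hint).symm

end Mollification

/-! ### The energy identity -/

section Energy

theorem exists_norm_le_of_hasCompactSupport {θ : ℝ → ℝ} (hθ : Continuous θ)
    (hs : HasCompactSupport θ) : ∃ M, ∀ t, |θ t| ≤ M :=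
  hs.exists_bound_of_continuous hθ

theorem MeasureTheory.MemLp.continuous_smul {E : Type*} [NormedAddCommGroup E] [NormedSpace ℝ E]
    {p : ℝ≥0∞} {μ : Measure ℝ} {f : ℝ → E} (hf : MemLp f p μ) {θ : ℝ → ℝ} (hθ : Continuous θ)
    (hs : HasCompactSupport θ) : MemLp (fun t => θ t • f t) p μ := by
  obtain ⟨M, hM⟩ := exists_norm_le_of_hasCompactSupport hθ hs
  exact hf.smul (memLp_top_of_bound hθ.aestronglyMeasurable M (ae_of_all _ hM))

theorem integral_neg_add_add_sub {α : Type*} [MeasurableSpace α] {μ : Measure α}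
    {f g h k : α → ℝ} (hf : Integrable f μ) (hg : Integrable g μ) (hh : Integrable h μ)
    (hk : Integrable k μ) :
    ∫ x, (-f x + g x + h x - k x) ∂μ
      = -(∫ x, f x ∂μ) + (∫ x, g x ∂μ) + (∫ x, h x ∂μ) - ∫ x, k x ∂μ := by
  rw [integral_sub (f := fun x => -f x + g x + h x) ((hf.neg.add hg).add hh) hk,
    integral_add (f := fun x => -f x + g x) (hf.neg.add hg) hh,
    integral_add (f := fun x => -f x) hf.neg hg, integral_neg]

universe u

variable {H K : Type u} [NormedAddCommGroup H] [InnerProductSpace ℝ H]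
  [NormedAddCommGroup K] [InnerProductSpace ℝ K]

theorem integrable_prod_indicator_kernel {T : ℝ} {b v : ℝ → H}
    (hb : MemLp b 2 (volume.restrict (Ioo 0 T))) (hv : MemLp v 2 (volume.restrict (Ioo 0 T)))
    {χ η k : ℝ → ℝ} (hχ : Continuous χ) (hχs : HasCompactSupport χ) (hη : Continuous η)
    (hηs : HasCompactSupport η) (hk : Continuous k) (hks : HasCompactSupport k) :
    Integrable (fun z : ℝ × ℝ => k (z.2 - z.1) *
      ⟪(Ioo 0 T).indicator (fun t => χ t • b t) z.1, (Ioo 0 T).indicator (fun t => η t • v t) z.2⟫_ℝ)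
      (volume.prod volume) := by
  obtain ⟨M, hM⟩ := exists_norm_le_of_hasCompactSupport hk hks
  refine integrable_kernel_mul_inner ?_ ?_ (k := fun z => k (z.2 - z.1))
    (hk.comp (continuous_snd.sub continuous_fst)) (fun z => hM _)
  · rw [integrable_indicator_iff measurableSet_Ioo]
    exact (hb.continuous_smul hχ hχs).integrable (by norm_num)
  · rw [integrable_indicator_iff measurableSet_Ioo]
    exact (hv.continuous_smul hη hηs).integrable (by norm_num)

/-- Cutting off sharply at `0` and `T` costs nothing because only square integrability on the line
is needed. In particular `χ` and `η` need not vanish at `0`. -/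
theorem tendsto_integral_prod_indicator_mollifier [CompleteSpace H] {T : ℝ} {b v : ℝ → H}
    (hb : MemLp b 2 (volume.restrict (Ioo 0 T))) (hv : MemLp v 2 (volume.restrict (Ioo 0 T)))
    {χ η : ℝ → ℝ} (hχ : Continuous χ) (hχs : HasCompactSupport χ) (hη : Continuous η)
    (hηs : HasCompactSupport η) {φ : ℕ → ContDiffBump (0 : ℝ)}
    (hφ : Tendsto (fun i => (φ i).rOut) atTop (𝓝 0)) :
    Tendsto (fun i => ∫ z : ℝ × ℝ, (φ i).normed volume (z.2 - z.1) *
      ⟪(Ioo 0 T).indicator (fun t => χ t • b t) z.1, (Ioo 0 T).indicator (fun t => η t • v t) z.2⟫_ℝ)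
      atTop (𝓝 (∫ t in Ioo 0 T, χ t * η t * ⟪b t, v t⟫_ℝ)) := by
  have h1 := hb.continuous_smul hχ hχs
  have h2 := hv.continuous_smul hη hηs
  have := tendsto_integral_mollifier_inner hφ (f := (Ioo 0 T).indicator (fun t => χ t • b t))
    (g := (Ioo 0 T).indicator (fun t => η t • v t))
    ((integrable_indicator_iff measurableSet_Ioo).2 (h1.integrable (by norm_num)))
    ((integrable_indicator_iff measurableSet_Ioo).2 (h2.integrable (by norm_num)))
    ((memLp_indicator_iff_restrict measurableSet_Ioo).2 h1)
    ((memLp_indicator_iff_restrict measurableSet_Ioo).2 h2)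
  convert this using 2
  rw [← integral_indicator measurableSet_Ioo]
  refine integral_congr_ae (ae_of_all _ fun t => ?_)
  by_cases ht : t ∈ Ioo 0 T
  · simp [ht, inner_smul_left, inner_smul_right, mul_assoc, mul_left_comm]
  · simp [ht]

/-- The energy identity, obtained by testing the equation of `w` with a mollification of `w`. -/
theorem energy_identity [CompleteSpace H] [CompleteSpace K] {T : ℝ} {w f : ℝ → H} {d a : ℝ → K} {I : Set ℝ}
    (hw : MemLp w 2 (volume.restrict (Ioo 0 T))) (hf : MemLp f 2 (volume.restrict (Ioo 0 T)))
    (hd : MemLp d 2 (volume.restrict (Ioo 0 T))) (ha : MemLp a 2 (volume.restrict (Ioo 0 T)))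
    (heq : ∀ᵐ s ∂(volume.restrict (Ioo 0 T)), ∀ θ : ℝ → ℝ, ContDiff ℝ ∞ θ → HasCompactSupport θ →
      tsupport θ ⊆ I → -(∫ t in Ioo 0 T, deriv θ t * ⟪w t, w s⟫_ℝ)
        + ∫ t in Ioo 0 T, θ t * ⟪a t, d s⟫_ℝ = ∫ t in Ioo 0 T, θ t * ⟪f t, w s⟫_ℝ)
    {χ : ℝ → ℝ} (hχ : ContDiff ℝ ∞ χ) (hχs : HasCompactSupport χ) (hχI : tsupport χ ⊆ I) :
    -(∫ t in Ioo 0 T, deriv χ t * χ t * ⟪w t, w t⟫_ℝ) + ∫ t in Ioo 0 T, χ t * χ t * ⟪a t, d t⟫_ℝ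
      = ∫ t in Ioo 0 T, χ t * χ t * ⟪f t, w t⟫_ℝ := by
  have hχc := hχ.continuous
  have hχ'c : Continuous (deriv χ) := hχ.continuous_deriv (by simp)
  have hχ's : HasCompactSupport (deriv χ) := hχs.deriv
  let φ : ℕ → ContDiffBump (0 : ℝ) := fun i =>
    ⟨1 / ((i : ℝ) + 1) / 2, 1 / ((i : ℝ) + 1), by positivity, half_lt_self (by positivity)⟩
  have hφ : Tendsto (fun i => (φ i).rOut) atTop (𝓝 0) := tendsto_one_div_add_atTop_nhds_zero_nat
  have l1 := tendsto_integral_prod_indicator_mollifier hw hw hχ'c hχ's hχc hχs hφ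
  have l3 := tendsto_integral_prod_indicator_mollifier ha hd hχc hχs hχc hχs hφ
  have l4 := tendsto_integral_prod_indicator_mollifier hf hw hχc hχs hχc hχs hφ
  refine tendsto_nhds_unique ((l1.neg.add l3).congr fun i => ?_) l4
  set ρ := (φ i).normed volume with hρ
  have hρd : ContDiff ℝ ∞ ρ := (φ i).contDiff_normed
  have hρc : Continuous ρ := hρd.continuous
  have hρs : HasCompactSupport ρ := (φ i).hasCompactSupport_normed
  have hρ'c : Continuous (deriv ρ) := hρd.continuous_deriv (by simp)
  have hρodd : ∀ x, deriv ρ (-x) = -deriv ρ x := by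
    intro x
    have h1 : (fun y => ρ (-y)) = ρ := funext fun y => (φ i).normed_neg y
    have h2 := deriv_comp_neg ρ x
    rw [h1] at h2
    linarith
  have i1 := integrable_prod_indicator_kernel hw hw hχ'c hχ's hχc hχs hρc hρs
  have i2 := integrable_prod_indicator_kernel hw hw hχc hχs hχc hχs hρ'c hρs.deriv
  have i3 := integrable_prod_indicator_kernel ha hd hχc hχs hχc hχs hρc hρs
  have i4 := integrable_prod_indicator_kernel hf hw hχc hχs hχc hχs hρc hρs
  -- The only term that could blow up with the mollifier. Exchanging the two times leaves the inner
  -- product unchanged and reverses the sign of the odd kernel, so it is zero at every scale.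
  have z2 : ∫ z : ℝ × ℝ, deriv ρ (z.2 - z.1) *
      ⟪(Ioo 0 T).indicator (fun t => χ t • w t) z.1,
        (Ioo 0 T).indicator (fun t => χ t • w t) z.2⟫_ℝ ∂(volume.prod volume) = 0 := by
    have := integral_prod_swap (μ := (volume : Measure ℝ)) (ν := (volume : Measure ℝ))
      (fun z : ℝ × ℝ => deriv ρ (z.2 - z.1) *
      ⟪(Ioo 0 T).indicator (fun t => χ t • w t) z.1,
        (Ioo 0 T).indicator (fun t => χ t • w t) z.2⟫_ℝ)
    have h2 : ∀ z : ℝ × ℝ, deriv ρ (z.swap.2 - z.swap.1) *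
      ⟪(Ioo 0 T).indicator (fun t => χ t • w t) z.swap.1,
        (Ioo 0 T).indicator (fun t => χ t • w t) z.swap.2⟫_ℝ = - (deriv ρ (z.2 - z.1) *
      ⟪(Ioo 0 T).indicator (fun t => χ t • w t) z.1,
        (Ioo 0 T).indicator (fun t => χ t • w t) z.2⟫_ℝ) := by
      intro z
      rw [Prod.fst_swap, Prod.snd_swap, ← neg_sub z.2 z.1, hρodd, real_inner_comm]
      ring
    simp only [h2, integral_neg] at this
    linarith
  have hsum := ((i1.neg.add i2).add i3).sub i4
  have hfub : ∀ P : ℝ × ℝ → ℝ, Integrable P (volume.prod volume) →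
      (∀ᵐ s, ∫ t, P (t, s) = 0) → ∫ z, P z ∂(volume.prod volume) = 0 := fun P hP h => by
    rw [integral_prod_symm _ hP]
    exact integral_eq_zero_of_ae h
  have hzero := hfub _ hsum (by
    have heq' := (ae_restrict_iff' measurableSet_Ioo).1 heq
    filter_upwards [i1.prod_left_ae, i2.prod_left_ae, i3.prod_left_ae, i4.prod_left_ae, heq']
      with s j1 j2 j3 j4 hs
    simp only [Pi.sub_apply, Pi.add_apply, Pi.neg_apply]
    rw [integral_neg_add_add_sub j1 j2 j3 j4]
    by_cases hsT : s ∈ Ioo 0 T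
    swap
    · simp [hsT]
    -- At frozen `s` the test pair is `χ(t)ρ(s - t)` and `w(s)`. The support stays in that of `χ`,
    -- hence in `I`, whatever `s` is. The outer factor `χ(s)` appears after the integral is pulled
    -- out, making the expression symmetric in the two times.
    have hθd : ContDiff ℝ ∞ fun t => χ t * ρ (s - t) :=
      hχ.mul (hρd.comp (contDiff_const.sub contDiff_id))
    have hs' := hs hsT (fun t => χ t * ρ (s - t)) hθd hχs.mul_right
      ((tsupport_mul_subset_left).trans hχI)
    have hder : ∀ t, deriv (fun t => χ t * ρ (s - t)) t
        = deriv χ t * ρ (s - t) - χ t * deriv ρ (s - t) := by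
      intro t
      have e1 : HasDerivAt χ (deriv χ t) t := (hχ.differentiable (by simp) t).hasDerivAt
      have e2 : HasDerivAt ρ (deriv ρ (s - t)) (s - t) :=
        (hρd.differentiable (by simp) _).hasDerivAt
      have e3 := e2.comp t ((hasDerivAt_id t).const_sub s)
      have := (e1.mul e3).deriv
      simp only [Function.comp_def, mul_neg, mul_one] at this
      exact this.trans (by simp [sub_eq_add_neg])
    have key : ∀ {E : Type u} [NormedAddCommGroup E] [InnerProductSpace ℝ E] (η k : ℝ → ℝ)
        (b v : ℝ → E), (∫ t, k (s - t) * ⟪(Ioo 0 T).indicator (fun t => η t • b t) t,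
          (Ioo 0 T).indicator (fun t => χ t • v t) s⟫_ℝ)
          = χ s * ∫ t in Ioo 0 T, η t * k (s - t) * ⟪b t, v s⟫_ℝ := by
      intro E _ _ η k b v
      rw [← integral_const_mul, ← integral_indicator measurableSet_Ioo]
      refine integral_congr_ae (ae_of_all _ fun t => ?_)
      by_cases ht : t ∈ Ioo 0 T
      · simp only [ht, hsT, indicator_of_mem, inner_smul_left, inner_smul_right]
        simp only [conj_trivial]; ring
      · simp [ht]
    -- Integrability at frozen `s` is read off from Fubini on the product, where the integrand
    -- carries a factor `χ(s)`; where that factor vanishes there is nothing to prove.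
    have keyi : ∀ (η k : ℝ → ℝ) (b v : ℝ → H), χ s ≠ 0 →
        Integrable (fun t => k (s - t) * ⟪(Ioo 0 T).indicator (fun t => η t • b t) t,
          (Ioo 0 T).indicator (fun t => χ t • v t) s⟫_ℝ) →
        IntegrableOn (fun t => η t * k (s - t) * ⟪b t, v s⟫_ℝ) (Ioo 0 T) := by
      intro η k b v hne hI
      rw [← integrable_indicator_iff measurableSet_Ioo]
      refine (hI.const_mul (χ s)⁻¹).congr (ae_of_all _ fun t => ?_)
      by_cases ht : t ∈ Ioo 0 T
      · simp only [ht, hsT, indicator_of_mem, inner_smul_left, inner_smul_right]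
        simp only [conj_trivial]; field_simp
      · simp [ht]
    rw [key (deriv χ) ρ w w, key χ (deriv ρ) w w, key χ ρ a d, key χ ρ f w, ← hs']
    by_cases hne : χ s = 0
    · simp [hne]
    have k1 := keyi _ _ _ _ hne j1
    have k2 := keyi _ _ _ _ hne j2
    have : ∫ t in Ioo 0 T, deriv (fun t => χ t * ρ (s - t)) t * ⟪w t, w s⟫_ℝ
        = (∫ t in Ioo 0 T, deriv χ t * ρ (s - t) * ⟪w t, w s⟫_ℝ)
          - ∫ t in Ioo 0 T, χ t * deriv ρ (s - t) * ⟪w t, w s⟫_ℝ := by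
      rw [← integral_sub k1 k2]
      refine integral_congr_ae (ae_of_all _ fun t => ?_)
      simp only [hder]; ring
    rw [this]; ring)
  simp only [Pi.sub_apply, Pi.add_apply, Pi.neg_apply] at hzero
  rw [integral_neg_add_add_sub i1 i2 i3 i4, z2] at hzero
  rw [Measure.volume_eq_prod]
  linarith

end Energy

/-! ### One-dimensional arguments in time: polarization, boundedness, Gronwall -/

section TestInTime

open scoped Convolution

theorem MeasureTheory.IntegrableOn.continuous_mul_of_hasCompactSupport {s : Set ℝ} {e θ : ℝ → ℝ}
    (he : IntegrableOn e s) (hθ : Continuous θ) (hs : HasCompactSupport θ) :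
    IntegrableOn (fun t => θ t * e t) s := by
  obtain ⟨M, hM⟩ := exists_norm_le_of_hasCompactSupport hθ hs
  exact he.bdd_mul hθ.aestronglyMeasurable (ae_of_all _ hM)

theorem Ioo_zero_eq_ball (T : ℝ) : Ioo 0 T = Metric.ball (T / 2) (T / 2) := by
  rw [Real.ball_eq_Ioo]; simp

/-- Polarization of an identity that is quadratic in the test function. -/
theorem integral_deriv_mul_eq_of_quadratic {T : ℝ} {e l : ℝ → ℝ}
    (he : IntegrableOn e (Ioo 0 T)) (hl : IntegrableOn l (Ioo 0 T))
    (h : ∀ χ : ℝ → ℝ, ContDiff ℝ ∞ χ → HasCompactSupport χ → tsupport χ ⊆ Ioo 0 T →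
      ∫ t in Ioo 0 T, deriv χ t * χ t * e t = ∫ t in Ioo 0 T, χ t * χ t * l t)
    {η : ℝ → ℝ} (hη : ContDiff ℝ ∞ η) (hηs : HasCompactSupport η) (hηT : tsupport η ⊆ Ioo 0 T) :
    ∫ t in Ioo 0 T, deriv η t * e t = 2 * ∫ t in Ioo 0 T, η t * l t := by
  rcases le_or_gt T 0 with hT | hT
  · simp [Ioo_eq_empty_of_le hT]
  obtain ⟨r, hr, hηr⟩ := exists_lt_subset_ball (isClosed_tsupport η) (Ioo_zero_eq_ball T ▸ hηT)
  -- A cutoff equal to `1` on the support of `η`. The maximum with `T / 8` keeps its inner radius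
  -- positive, as `r` need not be.
  let κ : ContDiffBump (T / 2) := ⟨max r (T / 8), (max r (T / 8) + T / 2) / 2,
    lt_max_of_lt_right (by linarith), by have := max_lt hr (by linarith : T / 8 < T / 2); linarith⟩
  have hκd : ContDiff ℝ ∞ κ := κ.contDiff
  have hκT : tsupport κ ⊆ Ioo 0 T := by
    rw [κ.tsupport_eq, Ioo_zero_eq_ball]
    refine Metric.closedBall_subset_ball ?_
    change (max r (T / 8) + T / 2) / 2 < T / 2
    have := max_lt hr (by linarith : T / 8 < T / 2); linarith
  have hκη : ∀ t, κ t * η t = η t := by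
    intro t
    by_cases ht : t ∈ tsupport η
    · rw [κ.one_of_mem_closedBall, one_mul]
      exact Metric.ball_subset_closedBall (Metric.ball_subset_ball (le_max_left _ _) (hηr ht))
    · simp [image_eq_zero_of_notMem_tsupport ht]
  have hηdiff : Differentiable ℝ η := hη.differentiable (by simp)
  have hκdiff : Differentiable ℝ κ := hκd.differentiable (by simp)
  have hprod : ∀ t, deriv κ t * η t + κ t * deriv η t = deriv η t := by
    intro t
    have h1 := ((hκdiff t).hasDerivAt.mul (hηdiff t).hasDerivAt).deriv
    rw [← h1]
    congr 1
    exact funext hκη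
  have hp := h (fun t => κ t + η t) (hκd.add hη) (κ.hasCompactSupport.add hηs)
    ((tsupport_add _ _).trans (union_subset hκT hηT))
  have hm := h (fun t => κ t - η t) (hκd.sub hη) (κ.hasCompactSupport.sub hηs)
    ((tsupport_sub _ _).trans (union_subset hκT hηT))
  have hpc : ContDiff ℝ ∞ fun t => κ t + η t := hκd.add hη
  have hmc : ContDiff ℝ ∞ fun t => κ t - η t := hκd.sub hη
  have hps : HasCompactSupport fun t => κ t + η t := κ.hasCompactSupport.add hηs
  have hms : HasCompactSupport fun t => κ t - η t := κ.hasCompactSupport.sub hηs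
  have e1 := he.continuous_mul_of_hasCompactSupport
    ((hpc.continuous_deriv (by simp)).mul hpc.continuous) hps.mul_left
  have e2 := he.continuous_mul_of_hasCompactSupport
    ((hmc.continuous_deriv (by simp)).mul hmc.continuous) hms.mul_left
  have e3 := hl.continuous_mul_of_hasCompactSupport
    (hpc.continuous.mul hpc.continuous) hps.mul_left
  have e4 := hl.continuous_mul_of_hasCompactSupport
    (hmc.continuous.mul hmc.continuous) hms.mul_left
  -- Subtracting the identities for `κ + η` and `κ - η` leaves `2(κη)' = 2η'` on one side and `4κη =
  -- 4η` on the other.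
  have h2 : ∫ t in Ioo 0 T, 2 * (deriv η t * e t) = ∫ t in Ioo 0 T, 4 * (η t * l t) := by
    calc _ = (∫ t in Ioo 0 T, deriv (fun t => κ t + η t) t * (κ t + η t) * e t)
          - ∫ t in Ioo 0 T, deriv (fun t => κ t - η t) t * (κ t - η t) * e t := by
          refine Eq.trans ?_ (integral_sub e1 e2)
          refine integral_congr_ae (ae_of_all _ fun t => ?_)
          have d1 : deriv (fun t => κ t + η t) t = deriv κ t + deriv η t :=
            ((hκdiff t).hasDerivAt.add (hηdiff t).hasDerivAt).deriv
          have d2 : deriv (fun t => κ t - η t) t = deriv κ t - deriv η t :=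
            ((hκdiff t).hasDerivAt.sub (hηdiff t).hasDerivAt).deriv
          simp only [d1, d2]
          linear_combination (-2 * e t) * hprod t
      _ = (∫ t in Ioo 0 T, (κ t + η t) * (κ t + η t) * l t)
          - ∫ t in Ioo 0 T, (κ t - η t) * (κ t - η t) * l t := by rw [hp, hm]
      _ = _ := by
          refine (integral_sub e3 e4).symm.trans ?_
          refine integral_congr_ae (ae_of_all _ fun t => ?_)
          simp only [Pi.mul_apply]
          linear_combination (4 * l t) * hκη t
  rw [integral_const_mul, integral_const_mul] at h2
  linarith

/-- A function on `(0, T)` with an integrable weak derivative is essentially bounded. -/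
theorem exists_ae_bound_of_integral_deriv_mul {T : ℝ} (hT : 0 < T) {e l : ℝ → ℝ}
    (he : IntegrableOn e (Ioo 0 T)) (hl : IntegrableOn l (Ioo 0 T))
    (h : ∀ η : ℝ → ℝ, ContDiff ℝ ∞ η → HasCompactSupport η → tsupport η ⊆ Ioo 0 T →
      ∫ t in Ioo 0 T, deriv η t * e t = ∫ t in Ioo 0 T, η t * l t) :
    ∃ M, ∀ᵐ t ∂(volume.restrict (Ioo 0 T)), |e t| ≤ M := by
  let ψ₀ : ContDiffBump (T / 2) := ⟨T / 8, T / 4, by linarith, by linarith⟩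
  set ψ := ψ₀.normed volume with hψ
  have hψd : ContDiff ℝ ∞ ψ := ψ₀.contDiff_normed
  have hψT : tsupport ψ ⊆ Metric.ball (T / 2) (T / 2) := by
    rw [hψ, ψ₀.tsupport_normed_eq]
    exact Metric.closedBall_subset_ball (by change T / 4 < T / 2; linarith)
  -- Averages of `e` against probability densities are bounded independently of the density: two
  -- densities differ by the derivative of an admissible test function, of size at most `2`.
  have key : ∀ φ : ℝ → ℝ, ContDiff ℝ ∞ φ → HasCompactSupport φ → tsupport φ ⊆ Ioo 0 T →
      (∀ t, 0 ≤ φ t) → ∫ t, φ t = 1 →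
      |∫ t in Ioo 0 T, φ t * e t| ≤ |∫ t in Ioo 0 T, ψ t * e t| + 2 * ∫ t in Ioo 0 T, |l t| := by
    intro φ hφ hφs hφT hφ0 hφ1
    obtain ⟨r, hr, hsub⟩ := exists_lt_subset_ball
      ((isClosed_tsupport φ).union (isClosed_tsupport ψ))
      (union_subset (Ioo_zero_eq_ball T ▸ hφT) hψT)
    have hφz : ∀ t, t ∉ Metric.ball (T / 2) r → φ t - ψ t = 0 := fun t ht => by
      rw [image_eq_zero_of_notMem_tsupport fun hh => ht (hsub (Or.inl hh)),
        image_eq_zero_of_notMem_tsupport fun hh => ht (hsub (Or.inr hh)), sub_zero]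
    have hφi : Integrable φ := hφ.continuous.integrable_of_hasCompactSupport hφs
    have hψi : Integrable ψ := ψ₀.integrable_normed
    have hdi : Integrable fun t => φ t - ψ t := hφi.sub hψi
    -- Both densities have mass one, so this primitive vanishes to the right of their supports as
    -- well as to the left.
    set χ : ℝ → ℝ := fun t => ∫ s in Iic t, (φ s - ψ s) with hχ
    have hχ0 : χ = fun t => χ 0 + ∫ s in (0 : ℝ)..t, (φ s - ψ s) := by
      funext t
      rw [← intervalIntegral.integral_Iic_sub_Iic hdi.integrableOn hdi.integrableOn]
      simp only [hχ]; ring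
    have hderiv : ∀ t, HasDerivAt χ (φ t - ψ t) t := by
      intro t
      rw [hχ0]
      refine HasDerivAt.const_add _ ?_
      exact intervalIntegral.integral_hasDerivAt_right (hdi.intervalIntegrable)
        ((hφ.continuous.sub hψd.continuous) |>.stronglyMeasurableAtFilter volume (𝓝 t))
        (hφ.continuous.sub hψd.continuous).continuousAt
    have hdχ : deriv χ = fun t => φ t - ψ t := funext fun t => (hderiv t).deriv
    have hχd : ContDiff ℝ ∞ χ := by
      rw [contDiff_infty_iff_deriv, hdχ]
      exact ⟨fun t => (hderiv t).differentiableAt, hφ.sub hψd⟩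
    have hχsupp : tsupport χ ⊆ Metric.closedBall (T / 2) r := by
      refine closure_minimal (fun t ht => ?_) Metric.isClosed_closedBall
      by_contra hcon
      apply ht
      rw [Real.closedBall_eq_Icc, mem_Icc, not_and_or, not_le, not_le] at hcon
      rcases hcon with hc | hc
      · refine setIntegral_eq_zero_of_forall_eq_zero fun s hs => hφz s fun hs' => ?_
        rw [Real.ball_eq_Ioo] at hs'
        have := hs'.1
        have := mem_Iic.1 hs
        linarith
      · have : χ t = ∫ s, (φ s - ψ s) := by
          refine setIntegral_eq_integral_of_forall_compl_eq_zero fun s hs => hφz s fun hs' => ?_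
          rw [Real.ball_eq_Ioo] at hs'
          have := hs'.2
          rw [mem_Iic, not_le] at hs
          linarith
        rw [this, integral_sub hφi hψi, hφ1, hψ, ψ₀.integral_normed, sub_self]
    have hχT : tsupport χ ⊆ Ioo 0 T := by
      rw [Ioo_zero_eq_ball]
      exact hχsupp.trans (Metric.closedBall_subset_ball hr)
    have hχs : HasCompactSupport χ :=
      (isCompact_closedBall (T / 2) r).of_isClosed_subset (isClosed_tsupport χ) hχsupp
    have hχb : ∀ t, |χ t| ≤ 2 := by
      intro t
      calc |χ t| ≤ ∫ s in Iic t, ‖φ s - ψ s‖ :=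
            norm_integral_le_integral_norm (fun s => φ s - ψ s)
        _ ≤ ∫ s, ‖φ s - ψ s‖ := setIntegral_le_integral hdi.norm (ae_of_all _ fun _ => norm_nonneg _)
        _ ≤ ∫ s, (φ s + ψ s) := by
            refine integral_mono hdi.norm (hφi.add hψi) fun s => ?_
            have h1 := hφ0 s
            have h2 : 0 ≤ ψ s := ψ₀.nonneg_normed s
            simp only [Real.norm_eq_abs]
            exact abs_le.2 ⟨by linarith, by linarith⟩
        _ = 2 := by
            rw [integral_add hφi hψi, hφ1, hψ, ψ₀.integral_normed]; norm_num
    have hid := h χ hχd hχs hχT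
    have e1 := he.continuous_mul_of_hasCompactSupport hφ.continuous hφs
    have e2 := he.continuous_mul_of_hasCompactSupport hψd.continuous ψ₀.hasCompactSupport_normed
    have e3 : ∫ t in Ioo 0 T, deriv χ t * e t
        = (∫ t in Ioo 0 T, φ t * e t) - ∫ t in Ioo 0 T, ψ t * e t := by
      rw [← integral_sub e1 e2, hdχ]
      simp only [sub_mul]
    have e4 : |∫ t in Ioo 0 T, χ t * l t| ≤ 2 * ∫ t in Ioo 0 T, |l t| := by
      rw [← integral_const_mul]
      refine (norm_integral_le_integral_norm (fun t => χ t * l t)).trans ?_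
      refine integral_mono (hl.continuous_mul_of_hasCompactSupport hχd.continuous hχs).norm
        (hl.abs.const_mul 2) fun t => ?_
      simp only [norm_mul, Real.norm_eq_abs]
      exact mul_le_mul_of_nonneg_right (hχb t) (abs_nonneg _)
    have e5 : ∫ t in Ioo 0 T, φ t * e t
        = (∫ t in Ioo 0 T, ψ t * e t) + ∫ t in Ioo 0 T, χ t * l t := by linarith
    rw [e5]
    exact (abs_add_le _ _).trans (by linarith)
  refine ⟨|∫ t in Ioo 0 T, ψ t * e t| + 2 * ∫ t in Ioo 0 T, |l t|, ?_⟩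
  let φ : ℕ → ContDiffBump (0 : ℝ) := fun i =>
    ⟨1 / ((i : ℝ) + 1) / 2, 1 / ((i : ℝ) + 1), by positivity, half_lt_self (by positivity)⟩
  have hφ : Tendsto (fun i => (φ i).rOut) atTop (𝓝 0) := tendsto_one_div_add_atTop_nhds_zero_nat
  have hloc : LocallyIntegrable ((Ioo 0 T).indicator e) :=
    ((integrable_indicator_iff measurableSet_Ioo).2 he).locallyIntegrable
  rw [ae_restrict_iff' measurableSet_Ioo]
  -- Lebesgue differentiation: letting the density concentrate at `t` passes the uniform bound to `e
  -- t`.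
  filter_upwards [ContDiffBump.ae_convolution_tendsto_right_of_locallyIntegrable (μ := volume)
    (K := 2) hφ (Eventually.of_forall fun i => by
      change 1 / ((i : ℝ) + 1) ≤ 2 * (1 / ((i : ℝ) + 1) / 2); linarith) hloc] with t ht htT
  rw [indicator_of_mem htT] at ht
  refine le_of_tendsto ht.abs ?_
  obtain ⟨ε, hε, hball⟩ := Metric.isOpen_iff.1 isOpen_Ioo t htT
  filter_upwards [hφ.eventually_lt_const hε] with i hi
  have hsupp : tsupport (fun s => (φ i).normed volume (t - s)) ⊆ Metric.closedBall t (φ i).rOut := by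
    refine closure_minimal (fun s hs => ?_) Metric.isClosed_closedBall
    have : t - s ∈ Function.support ((φ i).normed volume) := hs
    rw [(φ i).support_normed_eq, mem_ball_zero_iff] at this
    rw [Metric.mem_closedBall, dist_comm, Real.dist_eq]
    exact this.le
  have := key (fun s => (φ i).normed volume (t - s))
    ((φ i).contDiff_normed.comp (contDiff_const.sub contDiff_id))
    ((isCompact_closedBall t _).of_isClosed_subset (isClosed_tsupport _) hsupp)
    (hsupp.trans ((Metric.closedBall_subset_ball hi).trans hball))
    (fun s => (φ i).nonneg_normed _)
    (by rw [integral_sub_left_eq_self ((φ i).normed volume)]; exact (φ i).integral_normed)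
  refine le_of_eq_of_le (congrArg abs ?_) this
  rw [convolution_eq_swap, ← integral_indicator measurableSet_Ioo]
  refine integral_congr_ae (ae_of_all _ fun s => ?_)
  by_cases hs : s ∈ Ioo 0 T <;> simp [hs]

/-- A Gronwall lemma in terms of test functions. -/
theorem ae_eq_zero_of_energy_inequality {T K : ℝ} {e : ℝ → ℝ}
    (he : IntegrableOn e (Ioo 0 T)) (he0 : ∀ t, 0 ≤ e t)
    (h : ∀ χ : ℝ → ℝ, ContDiff ℝ ∞ χ → HasCompactSupport χ → tsupport χ ⊆ Iio T →
      -(∫ t in Ioo 0 T, deriv χ t * χ t * e t) ≤ K * ∫ t in Ioo 0 T, χ t * χ t * e t) :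
    ∀ᵐ t ∂(volume.restrict (Ioo 0 T)), e t = 0 := by
  have main : ∀ T' < T, ∀ᵐ t ∂(volume.restrict (Ioo 0 T)), t < T' → e t = 0 := by
    intro T' hT'
    -- Chosen so that `χ₀' ≤ -(K + 1)χ₀`: the glue factor is nonincreasing in `t` and ends the
    -- support at `T'`. The transition factor below makes the support compact on the left and equals
    -- `1` for positive times, so it does not disturb this inequality where it is used.
    let χ₀ : ℝ → ℝ := fun t => Real.exp (-(K + 1) * t) * expNegInvGlue (T' - t)
    let χ : ℝ → ℝ := fun t => χ₀ t * Real.smoothTransition (t + 2)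
    have hχ₀d : ContDiff ℝ ∞ χ₀ :=
      (Real.contDiff_exp.comp (contDiff_const.mul contDiff_id)).mul
        (expNegInvGlue.contDiff.comp (contDiff_const.sub contDiff_id))
    have hχd : ContDiff ℝ ∞ χ :=
      hχ₀d.mul (Real.smoothTransition.contDiff.comp (contDiff_id.add contDiff_const))
    have hsupp : tsupport χ ⊆ Icc (-2) T' := by
      refine closure_minimal (fun t ht => ?_) isClosed_Icc
      by_contra hcon
      apply ht
      rw [mem_Icc, not_and_or, not_le, not_le] at hcon
      rcases hcon with hc | hc
      · simp [χ, Real.smoothTransition.zero_of_nonpos (by linarith : t + 2 ≤ 0)]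
      · simp [χ, χ₀, expNegInvGlue.zero_of_nonpos (by linarith : T' - t ≤ 0)]
    have hχs : HasCompactSupport χ :=
      isCompact_Icc.of_isClosed_subset (isClosed_tsupport χ) hsupp
    have hineq := h χ hχd hχs (hsupp.trans fun t ht => ht.2.trans_lt hT')
    have hχ0 : ∀ t, 0 ≤ χ t := fun t => mul_nonneg (mul_nonneg (Real.exp_pos _).le
      (expNegInvGlue.nonneg _)) (Real.smoothTransition.nonneg _)
    have hder : ∀ t, 0 < t → deriv χ t ≤ -(K + 1) * χ t := by
      intro t ht
      have heq : χ =ᶠ[𝓝 t] χ₀ := by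
        filter_upwards [lt_mem_nhds ht] with s hs
        simp [χ, Real.smoothTransition.one_of_one_le (by linarith : 1 ≤ s + 2)]
      rw [heq.deriv_eq, heq.eq_of_nhds]
      have h1 : HasDerivAt (fun t => Real.exp (-(K + 1) * t))
          (Real.exp (-(K + 1) * t) * (-(K + 1))) t := by
        simpa using ((hasDerivAt_id t).const_mul (-(K + 1))).exp
      have h2 : HasDerivAt (fun t => expNegInvGlue (T' - t)) (deriv expNegInvGlue (T' - t) * (-1)) t :=
        ((expNegInvGlue.contDiff (n := 1)).differentiable (by simp) (T' - t)).hasDerivAt.comp t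
          ((hasDerivAt_id t).const_sub T')
      have h3 : 0 ≤ deriv expNegInvGlue (T' - t) := expNegInvGlue.monotone.deriv_nonneg
      have h4 : deriv χ₀ t = _ := (h1.mul h2).deriv
      rw [h4]
      have := mul_nonneg (Real.exp_pos (-(K + 1) * t)).le h3
      simp only [χ₀]
      linarith
    have i1 := he.continuous_mul_of_hasCompactSupport
      ((hχd.continuous_deriv (by simp)).mul hχd.continuous) hχs.mul_left
    have i2 := he.continuous_mul_of_hasCompactSupport (hχd.continuous.mul hχd.continuous)
      hχs.mul_left
    have hle : ∫ t in Ioo 0 T, (K + 1) * (χ t * χ t * e t)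
        ≤ ∫ t in Ioo 0 T, -(deriv χ t * χ t * e t) := by
      refine setIntegral_mono_on (i2.const_mul _) i1.neg measurableSet_Ioo fun t ht => ?_
      have := mul_le_mul_of_nonneg_right (hder t ht.1) (mul_nonneg (hχ0 t) (he0 t))
      linarith
    rw [integral_const_mul, integral_neg] at hle
    -- With `X` the integral, `(K + 1)X ≤ KX` and `X ≥ 0`; the extra `1` in the exponential rate is
    -- what forces `X = 0`.
    have hz : ∫ t in Ioo 0 T, χ t * χ t * e t = 0 :=
      le_antisymm (by linarith) (integral_nonneg fun t => mul_nonneg (mul_self_nonneg _) (he0 t))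
    rw [integral_eq_zero_iff_of_nonneg (fun t => mul_nonneg (mul_self_nonneg _) (he0 t)) i2] at hz
    filter_upwards [hz, ae_restrict_mem measurableSet_Ioo] with t ht htT htT'
    have hpos : 0 < χ t := mul_pos (mul_pos (Real.exp_pos _)
      (expNegInvGlue.pos_of_pos (by linarith))) (Real.smoothTransition.pos_of_pos (by linarith [htT.1]))
    simpa [hpos.ne'] using ht
  have hall := ae_all_iff.2 fun j : ℕ => main (T - 1 / ((j : ℝ) + 1)) (by
    have : 0 < 1 / ((j : ℝ) + 1) := by positivity
    linarith)
  filter_upwards [hall, ae_restrict_mem measurableSet_Ioo] with t ht htT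
  obtain ⟨j, hj⟩ := exists_nat_one_div_lt (sub_pos.2 htT.2)
  exact ht j (by linarith)

end TestInTime

/-! ### The cone property and differences along segments -/

section Domain

variable {n : ℕ} {Ω : Set (Vec n)}

/-- The local cone property of a smooth domain: near each point of the closure, `Ω` contains all
segments `[x, x + z]` issuing from its points with `z` in a fixed ball. -/
theorem IsBoundedSmoothDomain.exists_cone (hΩ : IsBoundedSmoothDomain Ω) {x₀ : Vec n}
    (hx₀ : x₀ ∈ closure Ω) :
    ∃ ρ > (0 : ℝ), ∃ (c : Vec n) (δ : ℝ), 0 < δ ∧ ∀ x ∈ Ω ∩ Metric.ball x₀ ρ,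
      ∀ z ∈ Metric.ball c δ, ∀ t ∈ Icc (0 : ℝ) 1, x + t • z ∈ Ω := by
  by_cases hin : x₀ ∈ Ω
  · obtain ⟨ρ, hρ, hball⟩ := Metric.isOpen_iff.1 hΩ.isOpen x₀ hin
    refine ⟨ρ / 2, by positivity, 0, ρ / 2, by positivity, fun x hx z hz t ht => hball ?_⟩
    have h1 : ‖x - x₀‖ < ρ / 2 := mem_ball_iff_norm.1 hx.2
    have h2 : ‖z‖ < ρ / 2 := mem_ball_zero_iff.1 hz
    have h3 : ‖t • z‖ ≤ ‖z‖ := by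
      rw [norm_smul, Real.norm_of_nonneg ht.1]
      exact mul_le_of_le_one_left (norm_nonneg _) ht.2
    rw [mem_ball_iff_norm, add_sub_right_comm]
    linarith [norm_add_le (x - x₀) (t • z)]
  · have hfr : x₀ ∈ frontier Ω := by
      rw [frontier, hΩ.isOpen.interior_eq]; exact ⟨hx₀, hin⟩
    obtain ⟨e, he, r, hr, γ, hγ, hγe, hiff⟩ := hΩ.smooth_boundary x₀ hfr
    obtain ⟨L, U, hU, hL⟩ := (hγ.contDiffAt (x := x₀)).of_le (m := 1) (by simp)
      |>.exists_lipschitzOnWith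
    obtain ⟨r', hr', hUr⟩ := Metric.mem_nhds_iff.1 hU
    set ρ := min r r' with hρ
    have hρ0 : 0 < ρ := lt_min hr hr'
    -- Moving by `t(s e + y)` with `|y| < δ` raises the height by at least `t(s - δ)`. The graph
    -- rises by at most `Ltδ`, because `γ` ignores the component along `e`. The choice `(L + 1)δ = s
    -- / 2` leaves a margin `ts/2`, and `s = ρ/4` keeps the segment inside the ball of radius `ρ`.
    set s := ρ / 4 with hs
    have hs0 : 0 < s := by positivity
    set δ := s / (2 * ((L : ℝ) + 1)) with hδ
    have hL0 : (0 : ℝ) ≤ L := L.2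
    have hδ0 : 0 < δ := by positivity
    have hδs : ((L : ℝ) + 1) * δ = s / 2 := by rw [hδ]; field_simp
    have hδ1 : δ ≤ s / 2 := by nlinarith
    refine ⟨ρ / 2, by positivity, s • e, δ, hδ0, fun x hx z hz t ht => ?_⟩
    obtain ⟨y, rfl⟩ : ∃ y, z = s • e + y := ⟨z - s • e, by simp⟩
    have hy : ‖y‖ < δ := by simpa [mem_ball_iff_norm] using hz
    have h1 : ‖x - x₀‖ < ρ / 2 := mem_ball_iff_norm.1 hx.2
    have hty : ‖t • y‖ ≤ t * δ := by
      rw [norm_smul, Real.norm_of_nonneg ht.1]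
      exact mul_le_mul_of_nonneg_left hy.le ht.1
    have htδ : t * δ ≤ δ := mul_le_of_le_one_left hδ0.le ht.2
    have hts : t * s ≤ s := mul_le_of_le_one_left hs0.le ht.2
    have hxρ : x ∈ Metric.ball x₀ ρ := mem_ball_iff_norm.2 (by linarith)
    have hxyρ : x + t • y ∈ Metric.ball x₀ ρ := by
      rw [mem_ball_iff_norm, add_sub_right_comm]
      linarith [norm_add_le (x - x₀) (t • y)]
    have hxzρ : x + t • (s • e + y) ∈ Metric.ball x₀ ρ := by
      have h5 : x + t • (s • e + y) - x₀ = (x - x₀) + (t • y + (t * s) • e) := by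
        rw [smul_add, smul_smul]; abel
      have h6 : ‖(t * s) • e‖ = t * s := by
        rw [norm_smul, he, mul_one, Real.norm_of_nonneg (mul_nonneg ht.1 hs0.le)]
      rw [mem_ball_iff_norm, h5]
      linarith [norm_add_le (x - x₀) (t • y + (t * s) • e), norm_add_le (t • y) ((t * s) • e)]
    have hrr : Metric.ball x₀ ρ ⊆ Metric.ball x₀ r := Metric.ball_subset_ball (min_le_left _ _)
    have hrU : Metric.ball x₀ ρ ⊆ U := (Metric.ball_subset_ball (min_le_right _ _)).trans hUr
    rcases ht.1.eq_or_lt with h0 | h0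
    · simpa [← h0] using hx.1
    refine (hiff _ (hrr hxzρ)).2 ?_
    have g1 : γ (x + t • (s • e + y)) = γ (x + t • y) := by
      rw [← hγe (x + t • y) (t * s)]
      congr 1
      rw [smul_add, smul_smul]; abel
    have g2 : γ (x + t • y) ≤ γ x + L * (t * δ) := by
      have := hL.dist_le_mul _ (hrU hxyρ) _ (hrU hxρ)
      rw [Real.dist_eq, dist_eq_norm, add_sub_cancel_left] at this
      have := (le_abs_self _).trans this
      nlinarith [mul_le_mul_of_nonneg_left hty hL0]
    have g3 : γ x < ⟪x, e⟫_ℝ := (hiff _ (hrr hxρ)).1 hx.1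
    have g4 : ⟪x + t • (s • e + y), e⟫_ℝ = ⟪x, e⟫_ℝ + t * s + ⟪t • y, e⟫_ℝ := by
      rw [smul_add, inner_add_left, inner_add_left, smul_smul, real_inner_smul_left (e) e (t * s),
        real_inner_self_eq_norm_sq, he]
      ring
    have g5 : -(t * δ) ≤ ⟪t • y, e⟫_ℝ := by
      have := abs_real_inner_le_norm (t • y) e
      rw [he, mul_one] at this
      linarith [neg_abs_le ⟪t • y, e⟫_ℝ]
    rw [g1, g4]
    have : t * (((L : ℝ) + 1) * δ) < t * s := mul_lt_mul_of_pos_left (by linarith) h0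
    nlinarith

/-- A weakly differentiable function is the integral of its derivative along segments. -/
theorem ae_sub_eq_integral_of_weak_deriv {g b : Vec n → ℝ} (hg : Integrable g) (hb : Integrable b)
    (hbm : StronglyMeasurable b) {z : Vec n} {O : Set (Vec n)} (hO : IsOpen O)
    (hOΩ : ∀ x ∈ O, ∀ t ∈ Icc (0 : ℝ) 1, x + t • z ∈ Ω)
    (hweak : ∀ φ : Vec n → ℝ, IsTestFunction Ω φ →
      ∫ x, g x * fderiv ℝ φ x z = -∫ x, b x * φ x) :
    ∀ᵐ x, x ∈ O → g (x + z) - g x = ∫ t in Ioo (0 : ℝ) 1, b (x + t • z) := by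
  have hshift : Measurable fun q : Vec n × ℝ => q.1 + q.2 • z :=
    (continuous_fst.add (continuous_snd.smul continuous_const)).measurable
  have hbint : Integrable (fun q : Vec n × ℝ => b (q.1 + q.2 • z))
      ((volume : Measure (Vec n)).prod (volume.restrict (Ioo (0 : ℝ) 1))) := by
    refine (integrable_prod_iff' (hbm.comp_measurable hshift).aestronglyMeasurable).2 ⟨ae_of_all _ fun t => hb.comp_add_right (t • z), ?_⟩
    have : ∀ t : ℝ, ∫ x, ‖b (x + t • z)‖ = ∫ x, ‖b x‖ := fun t =>
      integral_add_right_eq_self (fun x => ‖b x‖) (t • z)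
    simp only [Function.comp_apply, this]
    exact integrable_const _
  have hBint : Integrable fun x => ∫ t in Ioo (0 : ℝ) 1, b (x + t • z) := hbint.integral_prod_left
  have hgz : Integrable fun x => g (x + z) := hg.comp_add_right z
  have hf : Integrable fun x => g (x + z) - g x - ∫ t in Ioo (0 : ℝ) 1, b (x + t • z) :=
    (hgz.sub hg).sub hBint
  -- The identity is checked against test functions on `O`: translations and the fundamental theorem
  -- of calculus are moved onto the smooth `φ`, and Fubini moves them back.
  have := hO.ae_eq_zero_of_integral_contDiff_smul_eq_zero (μ := volume)
    (hf.locallyIntegrable.locallyIntegrableOn O) (fun φ hφ hφs hφO => ?_)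
  · filter_upwards [this] with x hx hxO
    linarith [hx hxO]
  have hφc := hφ.continuous
  obtain ⟨M, hM⟩ := hφs.exists_bound_of_continuous hφc
  have hdφ : Continuous fun x => fderiv ℝ φ x z :=
    (hφ.continuous_fderiv (by simp)).clm_apply continuous_const
  obtain ⟨M', hM'⟩ := (hφs.fderiv_apply (𝕜 := ℝ) z).exists_bound_of_continuous hdφ
  have p1 : Integrable fun x => φ x * g (x + z) :=
    hgz.bdd_mul hφc.aestronglyMeasurable (ae_of_all _ hM)
  have p2 : Integrable fun x => φ x * g x := hg.bdd_mul hφc.aestronglyMeasurable (ae_of_all _ hM)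
  have p3 : Integrable fun x => φ x * ∫ t in Ioo (0 : ℝ) 1, b (x + t • z) :=
    hBint.bdd_mul hφc.aestronglyMeasurable (ae_of_all _ hM)
  have p4 : Integrable fun y => φ (y - z) * g y :=
    hg.bdd_mul (hφc.comp (continuous_id.sub continuous_const)).aestronglyMeasurable
      (ae_of_all _ fun y => hM _)
  have s1 : ∫ x, φ x * g (x + z) = ∫ y, φ (y - z) * g y := by
    rw [← integral_add_right_eq_self (fun y => φ (y - z) * g y) z]
    simp
  have hftc : ∀ y, φ (y - z) - φ y = ∫ t in Ioo (0 : ℝ) 1, -fderiv ℝ φ (y - t • z) z := by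
    intro y
    have hder : ∀ t : ℝ, HasDerivAt (fun t : ℝ => φ (y - t • z)) (-fderiv ℝ φ (y - t • z) z) t := by
      intro t
      have h1 := (hφ.differentiable (by simp) (y - t • z)).hasFDerivAt
      have h2 : HasDerivAt (fun t : ℝ => y - t • z) (-z) t := by
        simpa using ((hasDerivAt_id t).smul_const z).const_sub y
      simpa [Function.comp_def] using h1.comp_hasDerivAt t h2
    have hcont : Continuous fun t : ℝ => -fderiv ℝ φ (y - t • z) z :=
      (hdφ.comp (continuous_const.sub (continuous_id.smul continuous_const))).neg
    have := intervalIntegral.integral_eq_sub_of_hasDerivAt (a := 0) (b := 1) (fun t _ => hder t)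
      (hcont.intervalIntegrable _ _)
    rw [intervalIntegral.integral_of_le zero_le_one, integral_Ioc_eq_integral_Ioo] at this
    simpa using this.symm
  have hsec : ∀ t ∈ Ioo (0 : ℝ) 1,
      ∫ y, g y * -fderiv ℝ φ (y - t • z) z = ∫ x, φ x * b (x + t • z) := by
    intro t ht
    have hcomp : ContDiff ℝ ∞ fun y => φ (y - t • z) := hφ.comp (contDiff_id.sub contDiff_const)
    have himg : tsupport (fun y => φ (y - t • z)) ⊆ (fun x => x + t • z) '' tsupport φ := by
      refine closure_minimal (fun y hy => ⟨y - t • z, subset_tsupport _ hy, by simp⟩) ?_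
      exact (hφs.isCompact.image (continuous_id.add continuous_const)).isClosed
    -- The translated support lies in `Ω` exactly because the segments from points of `O` do.
    have htest : IsTestFunction Ω fun y => φ (y - t • z) := by
      refine ⟨hcomp, ?_, ?_⟩
      · exact (hφs.isCompact.image (continuous_id.add continuous_const)).of_isClosed_subset
          (isClosed_tsupport _) himg
      · refine himg.trans ?_
        rintro _ ⟨x, hx, rfl⟩
        exact hOΩ x (hφO hx) t ⟨ht.1.le, ht.2.le⟩
    have hw := hweak _ htest
    simp only [fderiv_comp_sub] at hw
    simp only [mul_neg, integral_neg, hw, neg_neg]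
    rw [← integral_add_right_eq_self (fun y => b y * φ (y - t • z)) (t • z)]
    simp [mul_comm]
  have hint2 : Integrable (fun q : Vec n × ℝ => g q.1 * -fderiv ℝ φ (q.1 - q.2 • z) z)
      ((volume : Measure (Vec n)).prod (volume.restrict (Ioo (0 : ℝ) 1))) := by
    have h1 : Integrable (fun q : Vec n × ℝ => g q.1)
        ((volume : Measure (Vec n)).prod (volume.restrict (Ioo (0 : ℝ) 1))) := hg.comp_fst _
    refine h1.mul_bdd (c := M') ?_ (ae_of_all _ fun q => ?_)
    · exact (hdφ.comp (continuous_fst.sub (continuous_snd.smul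
        continuous_const))).neg.aestronglyMeasurable
    · rw [norm_neg]; exact hM' _
  have hint3 : Integrable (fun q : Vec n × ℝ => φ q.1 * b (q.1 + q.2 • z))
      ((volume : Measure (Vec n)).prod (volume.restrict (Ioo (0 : ℝ) 1))) :=
    hbint.bdd_mul (hφc.comp continuous_fst).aestronglyMeasurable (ae_of_all _ fun q => hM _)
  have s2 : ∫ y, (φ (y - z) - φ y) * g y = ∫ x, φ x * ∫ t in Ioo (0 : ℝ) 1, b (x + t • z) := by
    calc ∫ y, (φ (y - z) - φ y) * g y
        = ∫ y, ∫ t in Ioo (0 : ℝ) 1, g y * -fderiv ℝ φ (y - t • z) z := by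
          refine integral_congr_ae (ae_of_all _ fun y => ?_)
          simp only
          rw [hftc y, integral_const_mul, mul_comm]
      _ = ∫ t in Ioo (0 : ℝ) 1, ∫ y, g y * -fderiv ℝ φ (y - t • z) z :=
          integral_integral_swap (f := fun y t => g y * -fderiv ℝ φ (y - t • z) z) hint2
      _ = ∫ t in Ioo (0 : ℝ) 1, ∫ x, φ x * b (x + t • z) :=
          setIntegral_congr_fun measurableSet_Ioo hsec
      _ = ∫ x, ∫ t in Ioo (0 : ℝ) 1, φ x * b (x + t • z) :=
          (integral_integral_swap (f := fun x t => φ x * b (x + t • z)) hint3).symm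
      _ = _ := by simp only [integral_const_mul]
  have s3 : ∫ x, φ x • (g (x + z) - g x - ∫ t in Ioo (0 : ℝ) 1, b (x + t • z))
      = (∫ x, φ x * g (x + z)) - (∫ x, φ x * g x)
        - ∫ x, φ x * ∫ t in Ioo (0 : ℝ) 1, b (x + t • z) := by
    rw [← integral_sub p1 p2]
    refine Eq.trans ?_ (integral_sub (p1.sub p2) p3)
    refine integral_congr_ae (ae_of_all _ fun x => ?_)
    simp only [smul_eq_mul]; ring
  rw [s3, s1, ← s2, ← integral_sub p4 p2, sub_eq_zero]
  simp only [sub_mul]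

end Domain

/-! ### Averaging segment bounds: Morrey and weighted Sobolev estimates -/

section Averaging

theorem ENNReal.add_sq_le_two_mul (a b : ℝ≥0∞) : (a + b) ^ 2 ≤ 2 * (a ^ 2 + b ^ 2) := by
  have := ENNReal.rpow_add_le_mul_rpow_add_rpow a b (p := 2) (by norm_num)
  norm_num at this
  exact this

theorem lintegral_mul_sq_le {α : Type*} [MeasurableSpace α] {μ : Measure α} {f g : α → ℝ≥0∞}
    (hf : AEMeasurable f μ) (hg : AEMeasurable g μ) :
    (∫⁻ x, f x * g x ∂μ) ^ 2 ≤ (∫⁻ x, f x ^ 2 ∂μ) * ∫⁻ x, g x ^ 2 ∂μ := by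
  have h := ENNReal.lintegral_mul_le_Lp_mul_Lq μ Real.HolderConjugate.two_two hf hg
  simp only [Pi.mul_apply, ENNReal.rpow_two] at h
  calc (∫⁻ x, f x * g x ∂μ) ^ 2
      ≤ ((∫⁻ x, f x ^ 2 ∂μ) ^ (1 / (2 : ℝ)) * (∫⁻ x, g x ^ 2 ∂μ) ^ (1 / (2 : ℝ))) ^ 2 := by gcongr
    _ = _ := by
        rw [mul_pow, ← ENNReal.rpow_two, ← ENNReal.rpow_two, ← ENNReal.rpow_mul, ← ENNReal.rpow_mul]
        norm_num

theorem setLIntegral_sq_le {α : Type*} [MeasurableSpace α] {μ : Measure α} {f : α → ℝ≥0∞}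
    (hf : AEMeasurable f μ) (s : Set α) :
    (∫⁻ x in s, f x ∂μ) ^ 2 ≤ μ s * ∫⁻ x in s, f x ^ 2 ∂μ := by
  have := lintegral_mul_sq_le (μ := μ.restrict s) (f := fun _ => 1) aemeasurable_const hf.restrict
  simpa using this

variable {n : ℕ}

/-- The Jacobian here is the source of every singular power of `t` in the estimates that follow. -/
theorem lintegral_comp_add_smul {h : Vec n → ℝ≥0∞} (hh : Measurable h) (y : Vec n) {t : ℝ}
    (ht : t ≠ 0) :
    ∫⁻ z, h (y + t • z) = ENNReal.ofReal (|t| ^ n)⁻¹ * ∫⁻ x, h x := by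
  have h1 : ∫⁻ z, h (y + t • z) = ∫⁻ x, h (y + x) ∂(Measure.map (fun x => t • x) volume) :=
    (lintegral_map (f := fun x => h (y + x)) (hh.comp (measurable_const_add y))
      (measurable_const_smul t)).symm
  rw [h1, Measure.map_addHaar_smul _ ht, lintegral_smul_measure, lintegral_add_left_eq_self]
  simp [abs_inv, abs_pow]

/-- Hölder's inequality on a dilated set. -/
theorem setLIntegral_comp_add_smul_le {h : Vec n → ℝ≥0∞} (hh : Measurable h) (y : Vec n) {t : ℝ}
    (ht : t ≠ 0) {q : ℝ} (hq : 1 < q) (S : Set (Vec n)) :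
    ∫⁻ z in S, h (y + t • z) ≤ ENNReal.ofReal (|t| ^ (-(n : ℝ) / q)) * volume S ^ (1 - 1 / q)
      * (∫⁻ x, h x ^ q) ^ (1 / q) := by
  have hconj := Real.HolderConjugate.conjExponent hq
  have hm : Measurable fun z => h (y + t • z) :=
    hh.comp ((measurable_const_smul t).const_add y)
  have h1 := ENNReal.lintegral_mul_le_Lp_mul_Lq (volume.restrict S) hconj
    (f := fun z => h (y + t • z)) (g := fun _ => 1) hm.aemeasurable aemeasurable_const
  simp only [Pi.mul_apply, mul_one, ENNReal.one_rpow, lintegral_const, one_mul,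
    Measure.restrict_apply_univ] at h1
  have h2 : ∫⁻ z in S, h (y + t • z) ^ q ≤ ENNReal.ofReal (|t| ^ n)⁻¹ * ∫⁻ x, h x ^ q := by
    rw [← lintegral_comp_add_smul (hh.pow_const q) y ht]
    exact setLIntegral_le_lintegral _ _
  have hexp : 1 / q.conjExponent = 1 - 1 / q := by
    have := hconj.inv_add_inv_eq_one
    rw [one_div, one_div]; linarith
  have htpos : 0 < |t| := abs_pos.2 ht
  have h3 : (ENNReal.ofReal (|t| ^ n)⁻¹) ^ (1 / q) = ENNReal.ofReal (|t| ^ (-(n : ℝ) / q)) := by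
    rw [ENNReal.ofReal_rpow_of_pos (by positivity), ← Real.rpow_natCast, ← Real.rpow_neg htpos.le,
      ← Real.rpow_mul htpos.le]
    congr 2
    ring
  calc ∫⁻ z in S, h (y + t • z)
      ≤ (∫⁻ z in S, h (y + t • z) ^ q) ^ (1 / q) * volume S ^ (1 / q.conjExponent) := h1
    _ ≤ (ENNReal.ofReal (|t| ^ n)⁻¹ * ∫⁻ x, h x ^ q) ^ (1 / q) * volume S ^ (1 - 1 / q) := by
        rw [hexp]; gcongr
    _ = _ := by
        rw [ENNReal.mul_rpow_of_nonneg _ _ (by positivity), h3]; ring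

theorem lintegral_rpow_Ioo_lt_top {a : ℝ} (ha : -1 < a) :
    ∫⁻ t in Ioo (0 : ℝ) 1, ENNReal.ofReal (t ^ a) < ⊤ := by
  have := (intervalIntegral.intervalIntegrable_rpow' (a := 0) (b := 1) ha)
  rw [intervalIntegrable_iff_integrableOn_Ioo_of_le zero_le_one] at this
  exact this.lintegral_lt_top

/-- Averaging a pointwise bound by values along segments over their directions. -/
theorem ae_measure_mul_le_of_segment {V G : Vec n → ℝ≥0∞} (hV : Measurable V) (hG : Measurable G)
    {O S : Set (Vec n)} {R : ℝ≥0∞}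
    (h : ∀ᵐ z ∂(volume.restrict S), ∀ᵐ x ∂(volume.restrict O),
      V x ≤ V (x + z) + R * ∫⁻ t in Ioo (0 : ℝ) 1, G (x + t • z)) :
    ∀ᵐ x ∂(volume.restrict O), volume S * V x ≤ (∫⁻ z in S, V (x + z))
      + R * ∫⁻ t in Ioo (0 : ℝ) 1, ∫⁻ z in S, G (x + t • z) := by
  have hm3 : Measurable fun q : (Vec n × Vec n) × ℝ => G (q.1.2 + q.2 • q.1.1) :=
    hG.comp ((measurable_snd.comp measurable_fst).add
      (measurable_snd.smul (measurable_fst.comp measurable_fst)))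
  have hm2 : Measurable fun q : Vec n × Vec n => ∫⁻ t in Ioo (0 : ℝ) 1, G (q.2 + t • q.1) :=
    hm3.lintegral_prod_right'
  have hms : MeasurableSet {q : Vec n × Vec n | V q.2 ≤ V (q.2 + q.1)
      + R * ∫⁻ t in Ioo (0 : ℝ) 1, G (q.2 + t • q.1)} :=
    measurableSet_le (hV.comp measurable_snd)
      ((hV.comp (measurable_snd.add measurable_fst)).add (hm2.const_mul R))
  -- The exceptional set of `x` depends on `z`; Fubini exchanges the two quantifiers so that `x` can
  -- be fixed and `z` averaged.
  have h' := (Measure.ae_ae_comm hms).1 h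
  filter_upwards [h'] with x hx
  have hmx : Measurable fun q : Vec n × ℝ => G (x + q.2 • q.1) :=
    hG.comp (measurable_const.add (measurable_snd.smul measurable_fst))
  calc volume S * V x = ∫⁻ _ in S, V x := by simp [mul_comm]
    _ ≤ ∫⁻ z in S, (V (x + z) + R * ∫⁻ t in Ioo (0 : ℝ) 1, G (x + t • z)) := lintegral_mono_ae hx
    _ = (∫⁻ z in S, V (x + z)) + R * ∫⁻ z in S, ∫⁻ t in Ioo (0 : ℝ) 1, G (x + t • z) := by
        rw [lintegral_add_left (f := fun z => V (x + z)) (hV.comp (measurable_const_add x)),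
          lintegral_const_mul _ hmx.lintegral_prod_right']
    _ = _ := by
        rw [lintegral_lintegral_swap (f := fun z t => G (x + t • z)) hmx.aemeasurable]

/-- Morrey's estimate. -/
theorem ae_measure_mul_le_of_segment_of_rpow {V G : Vec n → ℝ≥0∞} (hV : Measurable V)
    (hG : Measurable G) {O S : Set (Vec n)} {R : ℝ≥0∞} {q : ℝ} (hq : 1 < q)
    (h : ∀ᵐ z ∂(volume.restrict S), ∀ᵐ x ∂(volume.restrict O),
      V x ≤ V (x + z) + R * ∫⁻ t in Ioo (0 : ℝ) 1, G (x + t • z)) :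
    ∀ᵐ x ∂(volume.restrict O), volume S * V x ≤ (∫⁻ y, V y)
      + R * ((∫⁻ t in Ioo (0 : ℝ) 1, ENNReal.ofReal (t ^ (-(n : ℝ) / q)))
        * (volume S ^ (1 - 1 / q) * (∫⁻ y, G y ^ q) ^ (1 / q))) := by
  -- For each `t`, Hölder on the dilate `x + tS` costs `t ^ (-n / q)`, which is integrable on `(0,
  -- 1)` when `q > n`.
  filter_upwards [ae_measure_mul_le_of_segment hV hG h] with x hx
  refine hx.trans (add_le_add ?_ ?_)
  · exact (setLIntegral_le_lintegral _ _).trans_eq (lintegral_add_left_eq_self _ x)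
  · gcongr
    rw [← lintegral_mul_const]
    · refine setLIntegral_mono' measurableSet_Ioo fun t ht => ?_
      refine (setLIntegral_comp_add_smul_le hG x ht.1.ne' hq S).trans_eq ?_
      rw [abs_of_pos ht.1, mul_assoc]
    · exact (measurable_id.pow_const _).ennreal_ofReal

/-- A Sobolev estimate with a weight `h`. -/
theorem measure_sq_mul_lintegral_le {V G h : Vec n → ℝ≥0∞} (hV : Measurable V)
    (hG : Measurable G) (hh : Measurable h) {O S : Set (Vec n)} (hS : volume S ≠ ⊤)
    {R : ℝ≥0∞} {p : ℝ} (hp : 1 < p)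
    (hVG : ∀ᵐ z ∂(volume.restrict S), ∀ᵐ x ∂(volume.restrict O),
      V x ≤ V (x + z) + R * ∫⁻ t in Ioo (0 : ℝ) 1, G (x + t • z)) :
    volume S ^ 2 * ∫⁻ x in O, h x ^ 2 * V x ^ 2
      ≤ 2 * (volume S * (∫⁻ y, V y ^ 2) * ∫⁻ x, h x ^ 2)
        + 2 * (R ^ 2 * (volume S * volume S ^ (1 - 1 / p))
          * (∫⁻ t in Ioo (0 : ℝ) 1, ENNReal.ofReal (t ^ (-(n : ℝ) / (2 * p)))) ^ 2
          * (∫⁻ y, h y ^ (2 * p)) ^ (1 / p) * ∫⁻ y, G y ^ 2) := by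
  -- Bookkeeping of powers: Cauchy–Schwarz in `t` gives one factor `J` and leaves a weight `t ^ a`.
  -- Hölder for `h²` in `L^p` costs `t ^ (-2a)`. The product `t ^ (-a)` integrates to a second `J`,
  -- so the condition needed for finiteness is only `a < 1`, that is `p > n / 2`.
  set a : ℝ := (n : ℝ) / (2 * p) with ha
  have hna : -(n : ℝ) / (2 * p) = -a := by rw [ha]; ring
  rw [hna]
  set J : ℝ≥0∞ := ∫⁻ t in Ioo (0 : ℝ) 1, ENNReal.ofReal (t ^ (-a)) with hJ
  have hmx : ∀ x, Measurable fun q : ℝ × Vec n => G (x + q.1 • q.2) := fun x =>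
    hG.comp (measurable_const.add (measurable_fst.smul measurable_snd))
  have hpow : ∀ b : ℝ, Measurable fun t : ℝ => ENNReal.ofReal (t ^ b) := fun b =>
    (measurable_id.pow_const b).ennreal_ofReal
  -- Cauchy-Schwarz with the weight `t ^ (-a)`
  have hCS : ∀ x, (∫⁻ t in Ioo (0 : ℝ) 1, ∫⁻ z in S, G (x + t • z)) ^ 2
      ≤ J * ∫⁻ t in Ioo (0 : ℝ) 1, ENNReal.ofReal (t ^ a) *
          (volume S * ∫⁻ z in S, G (x + t • z) ^ 2) := by
    intro x
    have e1 : ∫⁻ t in Ioo (0 : ℝ) 1, ∫⁻ z in S, G (x + t • z)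
        = ∫⁻ t in Ioo (0 : ℝ) 1, ENNReal.ofReal (t ^ (-a / 2)) *
          (ENNReal.ofReal (t ^ (a / 2)) * ∫⁻ z in S, G (x + t • z)) := by
      refine setLIntegral_congr_fun measurableSet_Ioo fun t ht => ?_
      rw [← mul_assoc, ← ENNReal.ofReal_mul (Real.rpow_nonneg ht.1.le _), ← Real.rpow_add ht.1]
      simp [neg_div]
    rw [e1]
    refine (lintegral_mul_sq_le
      (g := fun t => ENNReal.ofReal (t ^ (a / 2)) * ∫⁻ z in S, G (x + t • z))
      (hpow (-a / 2)).aemeasurable ((hpow _).mul (hmx x).lintegral_prod_right').aemeasurable).trans ?_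
    refine mul_le_mul' (le_of_eq ?_) ?_
    · refine setLIntegral_congr_fun measurableSet_Ioo fun t ht => ?_
      rw [← ENNReal.ofReal_pow (Real.rpow_nonneg ht.1.le _), ← Real.rpow_natCast,
        ← Real.rpow_mul ht.1.le]
      congr 2; push_cast; ring
    · refine setLIntegral_mono' measurableSet_Ioo fun t ht => ?_
      rw [mul_pow, ← ENNReal.ofReal_pow (Real.rpow_nonneg ht.1.le _), ← Real.rpow_natCast,
        ← Real.rpow_mul ht.1.le]
      have : a / 2 * ((2 : ℕ) : ℝ) = a := by push_cast; ring
      rw [this]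
      gcongr
      exact setLIntegral_sq_le (hG.comp ((measurable_const_smul t).const_add x)).aemeasurable S
  have hpt : ∀ᵐ x ∂(volume.restrict O), volume S ^ 2 * (h x ^ 2 * V x ^ 2)
      ≤ 2 * (volume S * (∫⁻ y, V y ^ 2)) * h x ^ 2
        + 2 * (R ^ 2 * (J * volume S)) * (h x ^ 2 *
          ∫⁻ t in Ioo (0 : ℝ) 1, ENNReal.ofReal (t ^ a) * ∫⁻ z in S, G (x + t • z) ^ 2) := by
    filter_upwards [ae_measure_mul_le_of_segment hV hG hVG] with x hx
    have hV2 : (∫⁻ z in S, V (x + z)) ^ 2 ≤ volume S * ∫⁻ y, V y ^ 2 := by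
      refine (setLIntegral_sq_le (hV.comp (measurable_const_add x)).aemeasurable S).trans ?_
      refine mul_le_mul_right ?_ _
      exact (setLIntegral_le_lintegral _ _).trans_eq
        (lintegral_add_left_eq_self (fun y => V y ^ 2) x)
    have hCS' := hCS x
    have e2 : ∫⁻ t in Ioo (0 : ℝ) 1, ENNReal.ofReal (t ^ a) *
          (volume S * ∫⁻ z in S, G (x + t • z) ^ 2)
        = volume S * ∫⁻ t in Ioo (0 : ℝ) 1, ENNReal.ofReal (t ^ a) *
          ∫⁻ z in S, G (x + t • z) ^ 2 := by
      rw [← lintegral_const_mul' _ _ hS]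
      simp only [mul_left_comm]
    rw [e2] at hCS'
    calc volume S ^ 2 * (h x ^ 2 * V x ^ 2) = (volume S * V x) ^ 2 * h x ^ 2 := by ring
      _ ≤ ((∫⁻ z in S, V (x + z))
          + R * ∫⁻ t in Ioo (0 : ℝ) 1, ∫⁻ z in S, G (x + t • z)) ^ 2 * h x ^ 2 := by gcongr
      _ ≤ (2 * ((∫⁻ z in S, V (x + z)) ^ 2
          + (R * ∫⁻ t in Ioo (0 : ℝ) 1, ∫⁻ z in S, G (x + t • z)) ^ 2)) * h x ^ 2 := by
          gcongr; exact ENNReal.add_sq_le_two_mul _ _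
      _ ≤ (2 * (volume S * (∫⁻ y, V y ^ 2) + R ^ 2 * (J * (volume S *
          ∫⁻ t in Ioo (0 : ℝ) 1, ENNReal.ofReal (t ^ a) * ∫⁻ z in S, G (x + t • z) ^ 2))))
            * h x ^ 2 := by
          rw [mul_pow R]; gcongr
      _ = _ := by ring
  have hG2 : Measurable fun x => G x ^ 2 := hG.pow_const 2
  have hh2 : Measurable fun x => h x ^ 2 := hh.pow_const 2
  -- the double integral, after a translation
  have hD : ∀ t ∈ Ioo (0 : ℝ) 1, ∫⁻ x, h x ^ 2 * ∫⁻ z in S, G (x + t • z) ^ 2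
      ≤ ENNReal.ofReal (t ^ (-(2 * a))) * (volume S ^ (1 - 1 / p)
        * (∫⁻ y, h y ^ (2 * p)) ^ (1 / p) * ∫⁻ y, G y ^ 2) := by
    intro t ht
    have m1 : Measurable fun q : Vec n × Vec n => h q.1 ^ 2 * G (q.1 + t • q.2) ^ 2 :=
      (hh2.comp measurable_fst).mul
        (hG2.comp (measurable_fst.add (measurable_snd.const_smul t)))
    have m2 : Measurable fun q : Vec n × Vec n => h (q.2 - t • q.1) ^ 2 * G q.2 ^ 2 :=
      (hh2.comp (measurable_snd.sub (measurable_fst.const_smul t))).mul (hG2.comp measurable_snd)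
    calc ∫⁻ x, h x ^ 2 * ∫⁻ z in S, G (x + t • z) ^ 2
        = ∫⁻ x, ∫⁻ z in S, h x ^ 2 * G (x + t • z) ^ 2 := by
          refine lintegral_congr fun x => ?_
          rw [lintegral_const_mul]
          exact hG2.comp ((measurable_const_smul t).const_add x)
      _ = ∫⁻ z in S, ∫⁻ x, h x ^ 2 * G (x + t • z) ^ 2 :=
          lintegral_lintegral_swap m1.aemeasurable
      _ = ∫⁻ z in S, ∫⁻ y, h (y - t • z) ^ 2 * G y ^ 2 := by
          refine lintegral_congr fun z => ?_
          rw [← lintegral_add_right_eq_self (fun y => h (y - t • z) ^ 2 * G y ^ 2) (t • z)]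
          simp
      _ = ∫⁻ y, ∫⁻ z in S, h (y - t • z) ^ 2 * G y ^ 2 :=
          lintegral_lintegral_swap m2.aemeasurable
      _ ≤ ∫⁻ y, (ENNReal.ofReal (t ^ (-(2 * a))) * volume S ^ (1 - 1 / p)
            * (∫⁻ y, h y ^ (2 * p)) ^ (1 / p)) * G y ^ 2 := by
          refine lintegral_mono fun y => ?_
          simp only
          rw [lintegral_mul_const (f := fun z => h (y - t • z) ^ 2) _
            (hh2.comp ((measurable_const_smul t).const_sub y))]
          refine mul_le_mul_left ?_ _
          -- The shift now sits on the weight, so Hölder (on the dilate by `-t`) spends the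
          -- integrability of `h` and asks no more than `L²` of `G`.
          have := setLIntegral_comp_add_smul_le hh2 y (neg_ne_zero.2 ht.1.ne') hp S
          simp only [neg_smul, ← sub_eq_add_neg, abs_neg, abs_of_pos ht.1] at this
          refine this.trans (le_of_eq ?_)
          have e3 : -(n : ℝ) / p = -(2 * a) := by
            rw [ha]; field_simp
          have e4 : ∀ y, (h y ^ 2) ^ p = h y ^ (2 * p) := fun y => by
            rw [← ENNReal.rpow_two, ← ENNReal.rpow_mul]
          simp only [e3, e4]
      _ = _ := by
          rw [lintegral_const_mul _ hG2]; ring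
  have m3 : Measurable fun q : Vec n × ℝ => h q.1 ^ 2 * (ENNReal.ofReal (q.2 ^ a)
      * ∫⁻ z in S, G (q.1 + q.2 • z) ^ 2) := by
    refine (hh2.comp measurable_fst).mul (((hpow a).comp measurable_snd).mul ?_)
    refine Measurable.lintegral_prod_right'
      (f := fun q : (Vec n × ℝ) × Vec n => G (q.1.1 + q.1.2 • q.2) ^ 2) ?_
    exact hG2.comp ((measurable_fst.comp measurable_fst).add
      ((measurable_snd.comp measurable_fst).smul measurable_snd))
  have hT : ∫⁻ x, h x ^ 2 *
      ∫⁻ t in Ioo (0 : ℝ) 1, ENNReal.ofReal (t ^ a) * ∫⁻ z in S, G (x + t • z) ^ 2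
      ≤ J * (volume S ^ (1 - 1 / p) * (∫⁻ y, h y ^ (2 * p)) ^ (1 / p) * ∫⁻ y, G y ^ 2) := by
    calc _ = ∫⁻ x, ∫⁻ t in Ioo (0 : ℝ) 1, h x ^ 2 * (ENNReal.ofReal (t ^ a)
          * ∫⁻ z in S, G (x + t • z) ^ 2) := by
          refine lintegral_congr fun x => ?_
          rw [lintegral_const_mul]
          exact (hpow a).mul (((hmx x).pow_const 2).lintegral_prod_right')
      _ = ∫⁻ t in Ioo (0 : ℝ) 1, ∫⁻ x, h x ^ 2 * (ENNReal.ofReal (t ^ a)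
          * ∫⁻ z in S, G (x + t • z) ^ 2) := lintegral_lintegral_swap m3.aemeasurable
      _ ≤ ∫⁻ t in Ioo (0 : ℝ) 1, ENNReal.ofReal (t ^ (-a)) * (volume S ^ (1 - 1 / p)
          * (∫⁻ y, h y ^ (2 * p)) ^ (1 / p) * ∫⁻ y, G y ^ 2) := by
          refine setLIntegral_mono' measurableSet_Ioo fun t ht => ?_
          have e5 : ∫⁻ x, h x ^ 2 * (ENNReal.ofReal (t ^ a) * ∫⁻ z in S, G (x + t • z) ^ 2)
              = ENNReal.ofReal (t ^ a) * ∫⁻ x, h x ^ 2 * ∫⁻ z in S, G (x + t • z) ^ 2 := by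
            rw [← lintegral_const_mul' _ _ ENNReal.ofReal_ne_top]
            simp only [mul_left_comm]
          rw [e5]
          refine (mul_le_mul_right (hD t ht) _).trans (le_of_eq ?_)
          rw [← mul_assoc, ← ENNReal.ofReal_mul (Real.rpow_nonneg ht.1.le _),
            ← Real.rpow_add ht.1]
          congr 3; ring
      _ = _ := lintegral_mul_const _ (hpow _)
  have m4 : Measurable fun x => h x ^ 2 *
      ∫⁻ t in Ioo (0 : ℝ) 1, ENNReal.ofReal (t ^ a) * ∫⁻ z in S, G (x + t • z) ^ 2 := by
    refine hh2.mul (Measurable.lintegral_prod_right' (f := fun q : Vec n × ℝ =>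
      ENNReal.ofReal (q.2 ^ a) * ∫⁻ z in S, G (q.1 + q.2 • z) ^ 2) ?_)
    refine ((hpow a).comp measurable_snd).mul (Measurable.lintegral_prod_right'
      (f := fun q : (Vec n × ℝ) × Vec n => G (q.1.1 + q.1.2 • q.2) ^ 2) ?_)
    exact hG2.comp ((measurable_fst.comp measurable_fst).add
      ((measurable_snd.comp measurable_fst).smul measurable_snd))
  calc volume S ^ 2 * ∫⁻ x in O, h x ^ 2 * V x ^ 2
      = ∫⁻ x in O, volume S ^ 2 * (h x ^ 2 * V x ^ 2) :=
        (lintegral_const_mul _ (hh2.mul (hV.pow_const 2))).symm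
    _ ≤ ∫⁻ x in O, (2 * (volume S * (∫⁻ y, V y ^ 2)) * h x ^ 2
        + 2 * (R ^ 2 * (J * volume S)) * (h x ^ 2 *
          ∫⁻ t in Ioo (0 : ℝ) 1, ENNReal.ofReal (t ^ a) * ∫⁻ z in S, G (x + t • z) ^ 2)) :=
        lintegral_mono_ae hpt
    _ ≤ ∫⁻ x, (2 * (volume S * (∫⁻ y, V y ^ 2)) * h x ^ 2
        + 2 * (R ^ 2 * (J * volume S)) * (h x ^ 2 *
          ∫⁻ t in Ioo (0 : ℝ) 1, ENNReal.ofReal (t ^ a) * ∫⁻ z in S, G (x + t • z) ^ 2)) :=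
        setLIntegral_le_lintegral _ _
    _ = 2 * (volume S * (∫⁻ y, V y ^ 2)) * (∫⁻ x, h x ^ 2)
        + 2 * (R ^ 2 * (J * volume S)) * (∫⁻ x, h x ^ 2 *
          ∫⁻ t in Ioo (0 : ℝ) 1, ENNReal.ofReal (t ^ a) * ∫⁻ z in S, G (x + t • z) ^ 2) := by
        rw [lintegral_add_left (hh2.const_mul _), lintegral_const_mul _ hh2,
          lintegral_const_mul _ m4]
    _ ≤ 2 * (volume S * (∫⁻ y, V y ^ 2)) * (∫⁻ x, h x ^ 2)
        + 2 * (R ^ 2 * (J * volume S)) * (J * (volume S ^ (1 - 1 / p)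
          * (∫⁻ y, h y ^ (2 * p)) ^ (1 / p) * ∫⁻ y, G y ^ 2)) := by gcongr
    _ = _ := by ring

end Averaging

/-! ### Segment bounds for Sobolev functions and the sup bound -/

section Sobolev

variable {m n : ℕ} {Ω : Set (Vec n)}

theorem IsBoundedSmoothDomain.measurableSet (hΩ : IsBoundedSmoothDomain Ω) : MeasurableSet Ω :=
  hΩ.isOpen.measurableSet

theorem IsBoundedSmoothDomain.volume_lt_top (hΩ : IsBoundedSmoothDomain Ω) : volume Ω < ⊤ :=
  hΩ.isBounded.measure_lt_top

theorem fderiv_apply_eq_sum (φ : Vec n → ℝ) (x z : Vec n) :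
    fderiv ℝ φ x z = ∑ i, z i * partialDeriv i φ x := by
  conv_lhs => rw [← (EuclideanSpace.basisFun (Fin n) ℝ).sum_repr z]
  simp [partialDeriv]

theorem abs_sum_row_mul_le (ζ : Mat m n) (z : Vec n) (k : Fin m) :
    |∑ i, ζ (k, i) * z i| ≤ ‖ζ‖ * ‖z‖ := by
  refine abs_le_of_sq_le_sq ?_ (by positivity)
  rw [mul_pow, EuclideanSpace.norm_sq_eq, EuclideanSpace.norm_sq_eq]
  simp only [Real.norm_eq_abs, sq_abs]
  refine (Finset.sum_mul_sq_le_sq_mul_sq _ _ _).trans ?_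
  refine mul_le_mul_of_nonneg_right ?_ (Finset.sum_nonneg fun i _ => sq_nonneg _)
  rw [Fintype.sum_prod_type]
  exact Finset.single_le_sum (f := fun k => ∑ i, ζ (k, i) ^ 2)
    (fun k _ => Finset.sum_nonneg fun i _ => sq_nonneg _) (Finset.mem_univ k)

/-- The components of a Sobolev function have representatives that are controlled along
segments by the gradient. -/
theorem MemW12.exists_segment_bound (hΩ : IsBoundedSmoothDomain Ω) {v : Vec n → Vec m}
    {Dv : Vec n → Mat m n} (h : MemW12 Ω v Dv) (k : Fin m) :
    ∃ V G : Vec n → ℝ≥0∞, Measurable V ∧ Measurable G ∧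
      (V =ᵐ[volume] Ω.indicator fun x => ‖v x k‖ₑ) ∧
      (G =ᵐ[volume] Ω.indicator fun x => ‖Dv x‖ₑ) ∧
      ∀ (z : Vec n) (R : ℝ) (O : Set (Vec n)), IsOpen O → ‖z‖ ≤ R →
        (∀ x ∈ O, ∀ t ∈ Icc (0 : ℝ) 1, x + t • z ∈ Ω) →
        ∀ᵐ x ∂(volume.restrict O),
          V x ≤ V (x + z) + ENNReal.ofReal R * ∫⁻ t in Ioo (0 : ℝ) 1, G (x + t • z) := by
  have hΩm := hΩ.measurableSet
  have : IsFiniteMeasure (volume.restrict Ω) := ⟨by simpa using hΩ.volume_lt_top⟩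
  -- Strongly measurable representatives extended by zero, so that translates are defined
  -- everywhere. The extension need not be weakly differentiable across the boundary: the segments
  -- used stay inside `Ω`.
  set v' : Vec n → Vec m := Ω.indicator (h.memLp.1.mk v) with hv'
  set Dv' : Vec n → Mat m n := Ω.indicator (h.memLp_grad.1.mk Dv) with hDv'
  have hv'm : StronglyMeasurable v' := h.memLp.1.stronglyMeasurable_mk.indicator hΩm
  have hDv'm : StronglyMeasurable Dv' := h.memLp_grad.1.stronglyMeasurable_mk.indicator hΩm
  have hvae : v' =ᵐ[volume] Ω.indicator v :=
    (ae_eq_restrict_iff_indicator_ae_eq hΩm).1 h.memLp.1.ae_eq_mk.symm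
  have hDvae : Dv' =ᵐ[volume] Ω.indicator Dv :=
    (ae_eq_restrict_iff_indicator_ae_eq hΩm).1 h.memLp_grad.1.ae_eq_mk.symm
  have hvi : Integrable v' := by
    rw [integrable_congr hvae, integrable_indicator_iff hΩm]
    exact h.memLp.integrable (by norm_num)
  have hDvi : Integrable Dv' := by
    rw [integrable_congr hDvae, integrable_indicator_iff hΩm]
    exact h.memLp_grad.integrable (by norm_num)
  refine ⟨fun x => ‖v' x k‖ₑ, fun x => ‖Dv' x‖ₑ, ?_, hDv'm.measurable.enorm, ?_, ?_, ?_⟩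
  · exact ((EuclideanSpace.proj k).continuous.measurable.comp hv'm.measurable).enorm
  · filter_upwards [hvae] with x hx
    rw [hx]
    by_cases hxΩ : x ∈ Ω <;> simp [hxΩ]
  · filter_upwards [hDvae] with x hx
    rw [hx]
    by_cases hxΩ : x ∈ Ω <;> simp [hxΩ]
  intro z R O hO hzR hOΩ
  have hgi : Integrable fun x => v' x k :=
    (EuclideanSpace.proj k : Vec m →L[ℝ] ℝ).integrable_comp hvi
  have hDi : ∀ i, Integrable fun x => Dv' x (k, i) := fun i =>
    (EuclideanSpace.proj (k, i) : Mat m n →L[ℝ] ℝ).integrable_comp hDvi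
  have hbi : Integrable fun x => ∑ i, Dv' x (k, i) * z i :=
    integrable_finsetSum _ fun i _ => (hDi i).mul_const (z i)
  have hbm : StronglyMeasurable fun x => ∑ i, Dv' x (k, i) * z i := by
    refine Finset.stronglyMeasurable_fun_sum _ fun i _ => StronglyMeasurable.mul_const ?_ _
    exact (EuclideanSpace.proj (k, i) : Mat m n →L[ℝ] ℝ).continuous.comp_stronglyMeasurable hDv'm
  have key := ae_sub_eq_integral_of_weak_deriv (Ω := Ω) hgi hbi hbm hO hOΩ (fun φ hφ => by
    have hbd : ∀ ψ : Vec n → ℝ, Continuous ψ → HasCompactSupport ψ → ∀ f : Vec n → ℝ,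
        Integrable f → Integrable fun x => f x * ψ x := fun ψ hψ hψs f hf => by
      obtain ⟨M, hM⟩ := hψs.exists_bound_of_continuous hψ
      exact hf.mul_bdd hψ.aestronglyMeasurable (ae_of_all _ hM)
    have hpc : ∀ i, Continuous (partialDeriv i φ) := fun i =>
      (hφ.1.continuous_fderiv (by simp)).clm_apply continuous_const
    have hps : ∀ i, HasCompactSupport (partialDeriv i φ) := fun i =>
      hφ.2.1.fderiv_apply (𝕜 := ℝ) _
    have hcomp : ∀ i, ∫ x, v' x k * partialDeriv i φ x = -∫ x, Dv' x (k, i) * φ x := by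
      intro i
      have h1 : ∫ x, v' x k * partialDeriv i φ x = ∫ x in Ω, v x k * partialDeriv i φ x := by
        rw [← integral_indicator hΩm]
        refine integral_congr_ae ?_
        filter_upwards [hvae] with x hx
        rw [hx]
        by_cases hxΩ : x ∈ Ω <;> simp [hxΩ]
      have h2 : ∫ x, Dv' x (k, i) * φ x = ∫ x in Ω, Dv x (k, i) * φ x := by
        rw [← integral_indicator hΩm]
        refine integral_congr_ae ?_
        filter_upwards [hDvae] with x hx
        rw [hx]
        by_cases hxΩ : x ∈ Ω <;> simp [hxΩ]
      rw [h1, h2]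
      exact h.weak_grad φ hφ k i
    calc ∫ x, v' x k * fderiv ℝ φ x z = ∫ x, ∑ i, z i * (v' x k * partialDeriv i φ x) := by
          refine integral_congr_ae (ae_of_all _ fun x => ?_)
          simp only [fderiv_apply_eq_sum, Finset.mul_sum]
          exact Finset.sum_congr rfl fun i _ => by ring
      _ = ∑ i, z i * ∫ x, v' x k * partialDeriv i φ x := by
          rw [integral_finsetSum _ fun i _ => (hbd _ (hpc i) (hps i) _ hgi).const_mul (z i)]
          simp only [integral_const_mul]
      _ = -∑ i, z i * ∫ x, Dv' x (k, i) * φ x := by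
          simp only [hcomp, mul_neg, Finset.sum_neg_distrib]
      _ = -∫ x, ∑ i, z i * (Dv' x (k, i) * φ x) := by
          rw [integral_finsetSum _ fun i _ =>
            (hbd _ hφ.1.continuous hφ.2.1 _ (hDi i)).const_mul (z i)]
          simp only [integral_const_mul]
      _ = _ := by
          congr 1
          refine integral_congr_ae (ae_of_all _ fun x => ?_)
          simp only [Finset.sum_mul]
          exact Finset.sum_congr rfl fun i _ => by ring)
  rw [ae_restrict_iff' hO.measurableSet]
  filter_upwards [key] with x hx hxO
  have hx' := hx hxO
  have e1 : v' x k = v' (x + z) k - ∫ t in Ioo (0 : ℝ) 1, ∑ i, Dv' (x + t • z) (k, i) * z i := by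
    rw [← hx']; ring
  calc ‖v' x k‖ₑ ≤ ‖v' (x + z) k‖ₑ + ‖∫ t in Ioo (0 : ℝ) 1, ∑ i, Dv' (x + t • z) (k, i) * z i‖ₑ := by
        conv_lhs => rw [e1]
        exact enorm_sub_le
    _ ≤ ‖v' (x + z) k‖ₑ + ∫⁻ t in Ioo (0 : ℝ) 1, ‖∑ i, Dv' (x + t • z) (k, i) * z i‖ₑ := by
        gcongr
        exact enorm_integral_le_lintegral_enorm _
    _ ≤ ‖v' (x + z) k‖ₑ + ∫⁻ t in Ioo (0 : ℝ) 1, ENNReal.ofReal R * ‖Dv' (x + t • z)‖ₑ := by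
        gcongr with t
        rw [← ofReal_norm, ← ofReal_norm, ← ENNReal.ofReal_mul ((norm_nonneg z).trans hzR)]
        refine ENNReal.ofReal_le_ofReal ((abs_sum_row_mul_le _ z k).trans ?_)
        rw [mul_comm]
        exact mul_le_mul_of_nonneg_right hzR (norm_nonneg _)
    _ = _ := by
        rw [lintegral_const_mul' _ _ ENNReal.ofReal_ne_top]

theorem lintegral_eq_setLIntegral_of_ae_eq_indicator {f g : Vec n → ℝ≥0∞} (hΩ : MeasurableSet Ω)
    (h : f =ᵐ[volume] Ω.indicator g) {F : ℝ≥0∞ → ℝ≥0∞} (hF : F 0 = 0) :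
    ∫⁻ x, F (f x) = ∫⁻ x in Ω, F (g x) := by
  rw [← lintegral_indicator hΩ]
  refine lintegral_congr_ae ?_
  filter_upwards [h] with x hx
  rw [hx]
  by_cases hxΩ : x ∈ Ω <;> simp [hxΩ, hF]

theorem enorm_apply_le (v : Vec m) (k : Fin m) : ‖v k‖ₑ ≤ ‖v‖ₑ := by
  rw [← ofReal_norm, ← ofReal_norm]
  exact ENNReal.ofReal_le_ofReal (PiLp.norm_apply_le v k)

theorem ENNReal.le_one_add_rpow (x : ℝ≥0∞) {q : ℝ} (hq : 1 ≤ q) : x ≤ 1 + x ^ q := by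
  rcases le_total x 1 with h | h
  · exact h.trans le_self_add
  · refine le_trans ?_ le_add_self
    simpa using ENNReal.rpow_le_rpow_of_exponent_le h hq

/-- Sobolev functions with gradient in `L^q`, `q > n`, are bounded. -/
theorem IsBoundedSmoothDomain.exists_sup_bound (hΩ : IsBoundedSmoothDomain Ω) {q : ℝ} (hq1 : 1 < q)
    (hq : (n : ℝ) < q) {M N : ℝ≥0∞} (hM : M ≠ ⊤) (hN : N ≠ ⊤) :
    ∃ B : ℝ≥0∞, B ≠ ⊤ ∧ ∀ (v : Vec n → Vec m) (Dv : Vec n → Mat m n), MemW12 Ω v Dv →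
      ∫⁻ x in Ω, ‖v x‖ₑ ^ 2 ≤ M → ∫⁻ x in Ω, ‖Dv x‖ₑ ^ q ≤ N →
      ∀ᵐ x ∂(volume.restrict Ω), ∀ k, ‖v x k‖ₑ ≤ B := by
  have hΩm := hΩ.measurableSet
  have hcomp : IsCompact (closure Ω) := hΩ.isBounded.isCompact_closure
  have hmain : ∃ B : ℝ≥0∞, B ≠ ⊤ ∧ ∀ (v : Vec n → Vec m) (Dv : Vec n → Mat m n), MemW12 Ω v Dv →
      ∫⁻ x in Ω, ‖v x‖ₑ ^ 2 ≤ M → ∫⁻ x in Ω, ‖Dv x‖ₑ ^ q ≤ N →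
      ∀ᵐ x ∂volume, x ∈ Ω ∩ closure Ω → ∀ k, ‖v x k‖ₑ ≤ B := by
    -- Cones exist only locally, so the bound is patched by compactness of the closure. The cones
    -- depend on `Ω` alone, hence the constant is uniform in `v`.
    refine hcomp.induction_on (p := fun s => ∃ B : ℝ≥0∞, B ≠ ⊤ ∧ ∀ (v : Vec n → Vec m)
      (Dv : Vec n → Mat m n), MemW12 Ω v Dv → ∫⁻ x in Ω, ‖v x‖ₑ ^ 2 ≤ M →
      ∫⁻ x in Ω, ‖Dv x‖ₑ ^ q ≤ N → ∀ᵐ x ∂volume, x ∈ Ω ∩ s → ∀ k, ‖v x k‖ₑ ≤ B) ?_ ?_ ?_ ?_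
    · exact ⟨0, by simp, fun v Dv _ _ _ => ae_of_all _ fun x hx => absurd hx.2 (by simp)⟩
    · rintro s t hst ⟨B, hB, h⟩
      refine ⟨B, hB, fun v Dv hv h1 h2 => ?_⟩
      filter_upwards [h v Dv hv h1 h2] with x hx hxs using hx ⟨hxs.1, hst hxs.2⟩
    · rintro s t ⟨B, hB, h⟩ ⟨B', hB', h'⟩
      refine ⟨max B B', by simp [hB, hB'], fun v Dv hv h1 h2 => ?_⟩
      filter_upwards [h v Dv hv h1 h2, h' v Dv hv h1 h2] with x hx hx' hxs k
      rcases hxs.2 with hs | hs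
      · exact (hx ⟨hxs.1, hs⟩ k).trans (le_max_left _ _)
      · exact (hx' ⟨hxs.1, hs⟩ k).trans (le_max_right _ _)
    · intro x₀ hx₀
      obtain ⟨ρ, hρ, c, δ, hδ, hcone⟩ := hΩ.exists_cone hx₀
      refine ⟨Metric.ball x₀ ρ, mem_nhdsWithin_of_mem_nhds (Metric.ball_mem_nhds x₀ hρ), ?_⟩
      set S := Metric.ball c δ with hS
      have hS0 : volume S ≠ 0 := (Metric.measure_ball_pos volume c hδ).ne'
      have hStop : volume S ≠ ⊤ := measure_ball_lt_top.ne
      -- The right side of Morrey's estimate, with `∫|v|` bounded by `|Ω| + M` through `y ≤ 1 + y²`.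
      set D : ℝ≥0∞ := (volume Ω + M) + ENNReal.ofReal (‖c‖ + δ) *
        ((∫⁻ t in Ioo (0 : ℝ) 1, ENNReal.ofReal (t ^ (-(n : ℝ) / q)))
          * (volume S ^ (1 - 1 / q) * N ^ (1 / q))) with hD
      have hJ : ∫⁻ t in Ioo (0 : ℝ) 1, ENNReal.ofReal (t ^ (-(n : ℝ) / q)) < ⊤ := by
        refine lintegral_rpow_Ioo_lt_top ?_
        rw [lt_div_iff₀ (by linarith)]; linarith
      have hq' : 0 ≤ 1 - 1 / q := by
        rw [sub_nonneg, div_le_one (by linarith)]; exact hq1.le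
      have hDtop : D ≠ ⊤ := by
        refine ENNReal.add_ne_top.2 ⟨ENNReal.add_ne_top.2 ⟨hΩ.volume_lt_top.ne, hM⟩, ?_⟩
        refine ENNReal.mul_ne_top ENNReal.ofReal_ne_top (ENNReal.mul_ne_top hJ.ne ?_)
        exact ENNReal.mul_ne_top (ENNReal.rpow_ne_top_of_nonneg hq' hStop)
          (ENNReal.rpow_ne_top_of_nonneg (by positivity) hN)
      refine ⟨D / volume S, ENNReal.div_ne_top hDtop hS0, fun v Dv hv h1 h2 => ?_⟩
      have hk : ∀ k, ∀ᵐ x ∂volume, x ∈ Ω ∩ Metric.ball x₀ ρ → ‖v x k‖ₑ ≤ D / volume S := by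
        intro k
        obtain ⟨V, G, hVm, hGm, hV, hG, hseg⟩ := hv.exists_segment_bound hΩ k
        have hO : IsOpen (Ω ∩ Metric.ball x₀ ρ) := hΩ.isOpen.inter Metric.isOpen_ball
        have hmor := ae_measure_mul_le_of_segment_of_rpow hVm hGm (O := Ω ∩ Metric.ball x₀ ρ)
          (S := S) (R := ENNReal.ofReal (‖c‖ + δ)) hq1 (by
            rw [ae_restrict_iff' Metric.isOpen_ball.measurableSet]
            refine ae_of_all _ fun z hz => hseg z _ _ hO ?_ fun x hx => hcone x hx z hz
            have : ‖z - c‖ < δ := mem_ball_iff_norm.1 hz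
            linarith [norm_le_insert' z c])
        rw [ae_restrict_iff' hO.measurableSet] at hmor
        filter_upwards [hmor, hV] with x hx hVx hxO
        have hx' := hx hxO
        rw [hVx, indicator_of_mem hxO.1] at hx'
        rw [ENNReal.le_div_iff_mul_le (Or.inl hS0) (Or.inl hStop), mul_comm]
        refine hx'.trans (add_le_add ?_ ?_)
        · have e1 := lintegral_eq_setLIntegral_of_ae_eq_indicator hΩm hV (F := id) rfl
          simp only [id] at e1
          rw [e1]
          calc ∫⁻ x in Ω, ‖v x k‖ₑ ≤ ∫⁻ x in Ω, (1 + ‖v x‖ₑ ^ 2) := by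
                refine lintegral_mono fun x => (enorm_apply_le _ k).trans ?_
                simpa using ENNReal.le_one_add_rpow ‖v x‖ₑ (q := 2) (by norm_num)
            _ = volume Ω + ∫⁻ x in Ω, ‖v x‖ₑ ^ 2 := by
                rw [lintegral_add_left measurable_const]; simp
            _ ≤ _ := by gcongr
        · have e2 := lintegral_eq_setLIntegral_of_ae_eq_indicator hΩm hG (F := fun y => y ^ q)
            (ENNReal.zero_rpow_of_pos (by linarith))
          rw [e2]
          gcongr
      filter_upwards [ae_all_iff.2 hk] with x hx hxO k using hx k hxO
  obtain ⟨B, hB, h⟩ := hmain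
  refine ⟨B, hB, fun v Dv hv h1 h2 => ?_⟩
  rw [ae_restrict_iff' hΩm]
  filter_upwards [h v Dv hv h1 h2] with x hx hxΩ using hx ⟨hxΩ, subset_closure hxΩ⟩

end Sobolev

/-! ### Weighted estimate with arbitrarily small gradient term -/

section WeightedSobolev

open scoped Pointwise

variable {m n : ℕ} {Ω : Set (Vec n)}

theorem tendsto_mul_ofReal_rpow_nhdsGT {K : ℝ≥0∞} (hK : K ≠ ⊤) {b : ℝ} (hb : 0 < b) :
    Tendsto (fun r : ℝ => K * ENNReal.ofReal (r ^ b)) (𝓝[>] 0) (𝓝 0) := by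
  have h1 : Tendsto (fun r : ℝ => r ^ b) (𝓝[>] 0) (𝓝 0) := by
    have := (Real.continuous_rpow_const hb.le).tendsto 0
    rw [Real.zero_rpow hb.ne'] at this
    exact this.mono_left nhdsWithin_le_nhds
  have h2 := ENNReal.tendsto_ofReal h1
  rw [ENNReal.ofReal_zero] at h2
  simpa using ENNReal.Tendsto.const_mul h2 (Or.inr hK)

/-- The weighted Sobolev estimate near a point of the closure. -/
theorem IsBoundedSmoothDomain.exists_local_weighted_bound (hΩ : IsBoundedSmoothDomain Ω) {p : ℝ}
    (hp1 : 1 < p) (hp : (n : ℝ) / 2 < p) {N : ℝ≥0∞} (hN : N ≠ ⊤) {x₀ : Vec n}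
    (hx₀ : x₀ ∈ closure Ω) :
    ∃ s ∈ 𝓝 x₀, ∀ ε : ℝ≥0∞, ε ≠ 0 → ∃ C : ℝ≥0∞, C ≠ ⊤ ∧ ∀ (v : Vec n → Vec m)
      (Dv : Vec n → Mat m n) (h : Vec n → ℝ≥0∞), MemW12 Ω v Dv → Measurable h →
      ∫⁻ x, h x ^ (2 * p) ≤ N → ∫⁻ x, h x ^ 2 ≤ volume Ω + N → ∀ k,
      ∫⁻ x in Ω ∩ s, h x ^ 2 * ‖v x k‖ₑ ^ 2
        ≤ ε * (∫⁻ x in Ω, ‖Dv x‖ₑ ^ 2) + C * ∫⁻ x in Ω, ‖v x‖ₑ ^ 2 := by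
  have hΩm := hΩ.measurableSet
  have hp0 : 0 < p := by linarith
  obtain ⟨ρ, hρ, c, δ, hδ, hcone⟩ := hΩ.exists_cone hx₀
  -- The neighbourhood is fixed before `ε`; only the averaging set will shrink with `ε`. Otherwise
  -- the compactness argument could not split `ε` over a finite cover.
  refine ⟨Metric.ball x₀ ρ, Metric.ball_mem_nhds x₀ hρ, fun ε hε => ?_⟩
  set μ := volume (Metric.ball c δ) with hμ
  have hμ0 : μ ≠ 0 := (Metric.measure_ball_pos volume c hδ).ne'
  have hμtop : μ ≠ ⊤ := measure_ball_lt_top.ne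
  set J := ∫⁻ t in Ioo (0 : ℝ) 1, ENNReal.ofReal (t ^ (-(n : ℝ) / (2 * p))) with hJ
  have hJtop : J ≠ ⊤ := by
    refine (lintegral_rpow_Ioo_lt_top ?_).ne
    rw [lt_div_iff₀ (by linarith)]; linarith
  set R := ‖c‖ + δ with hR
  have hR0 : 0 ≤ R := by positivity
  set K : ℝ≥0∞ := 2 * (ENNReal.ofReal R ^ 2 * μ ^ (-(1 / p)) * J ^ 2 * N ^ (1 / p)) with hK
  have hKtop : K ≠ ⊤ := by
    refine ENNReal.mul_ne_top (by simp) (ENNReal.mul_ne_top (ENNReal.mul_ne_top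
      (ENNReal.mul_ne_top (by simp) ?_) (ENNReal.pow_ne_top hJtop)) ?_)
    · exact ENNReal.rpow_ne_top_of_ne_zero hμ0 hμtop
    · exact ENNReal.rpow_ne_top_of_nonneg (by positivity) hN
  -- Scaling the averaging set by `r` multiplies the gradient coefficient by `r²` (squared segment
  -- length) times `r ^ (-n / p)` (from `|S| ^ (-1 / p)`); positivity of the exponent is again `p >
  -- n / 2`.
  have hb : 0 < 2 - (n : ℝ) / p := by
    rw [sub_pos, div_lt_iff₀ hp0]; linarith
  obtain ⟨r, hrε, hr⟩ := (((tendsto_mul_ofReal_rpow_nhdsGT hKtop hb).eventually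
    (ge_mem_nhds (pos_iff_ne_zero.2 hε))).and
      (Ioo_mem_nhdsGT (zero_lt_one' ℝ))).exists
  set S := r • Metric.ball c δ with hS
  have hSvol : volume S = ENNReal.ofReal (r ^ n) * μ := by
    rw [hS, Measure.addHaar_smul, finrank_euclideanSpace, Fintype.card_fin,
      abs_of_pos (pow_pos hr.1 n)]
  have hrn : ENNReal.ofReal (r ^ n) ≠ 0 := by
    rw [Ne, ENNReal.ofReal_eq_zero, not_le]; exact pow_pos hr.1 n
  have hS0 : volume S ≠ 0 := by rw [hSvol]; exact mul_ne_zero hrn hμ0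
  have hStop : volume S ≠ ⊤ := by rw [hSvol]; exact ENNReal.mul_ne_top (by simp) hμtop
  -- The zero-order coefficient after division by `|S|²`; `|Ω| + N` bounds `∫h²`.
  refine ⟨2 / volume S * (volume Ω + N), ?_, fun v Dv h hv hh hhp hh2 k => ?_⟩
  · exact ENNReal.mul_ne_top (ENNReal.div_ne_top (by simp) hS0)
      (ENNReal.add_ne_top.2 ⟨hΩ.volume_lt_top.ne, hN⟩)
  obtain ⟨V, G, hVm, hGm, hV, hG, hseg⟩ := hv.exists_segment_bound hΩ k
  have hO : IsOpen (Ω ∩ Metric.ball x₀ ρ) := hΩ.isOpen.inter Metric.isOpen_ball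
  have hSm : MeasurableSet S := Metric.isOpen_ball.measurableSet.const_smul_of_ne_zero hr.1.ne'
  have hsob := measure_sq_mul_lintegral_le hVm hGm hh (O := Ω ∩ Metric.ball x₀ ρ) (S := S) hStop
    (R := ENNReal.ofReal (r * R)) hp1 (by
      rw [ae_restrict_iff' hSm]
      refine ae_of_all _ fun z hz => ?_
      obtain ⟨y, hy, rfl⟩ := hz
      have hyn : ‖y - c‖ < δ := mem_ball_iff_norm.1 hy
      refine hseg _ _ _ hO ?_ fun x hx t ht => ?_
      · simp only
        rw [norm_smul, Real.norm_of_nonneg hr.1.le]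
        exact mul_le_mul_of_nonneg_left (by linarith [norm_le_insert' y c]) hr.1.le
      · simp only [smul_smul]
        exact hcone x hx y hy (t * r)
          ⟨mul_nonneg ht.1 hr.1.le, mul_le_one₀ ht.2 hr.1.le hr.2.le⟩)
  rw [← hJ] at hsob
  have eV : ∫⁻ y, V y ^ 2 ≤ ∫⁻ x in Ω, ‖v x‖ₑ ^ 2 := by
    rw [lintegral_eq_setLIntegral_of_ae_eq_indicator hΩm hV (F := fun y => y ^ 2) (by simp)]
    exact lintegral_mono fun x => by
      have := enorm_apply_le (v x) k
      simp only
      gcongr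
  have eG : ∫⁻ y, G y ^ 2 = ∫⁻ x in Ω, ‖Dv x‖ₑ ^ 2 :=
    lintegral_eq_setLIntegral_of_ae_eq_indicator hΩm hG (F := fun y => y ^ 2) (by simp)
  have eX : ∫⁻ x in Ω ∩ Metric.ball x₀ ρ, h x ^ 2 * V x ^ 2
      = ∫⁻ x in Ω ∩ Metric.ball x₀ ρ, h x ^ 2 * ‖v x k‖ₑ ^ 2 := by
    refine lintegral_congr_ae ?_
    filter_upwards [ae_restrict_of_ae hV, ae_restrict_mem hO.measurableSet] with x hx hxO
    rw [hx, indicator_of_mem hxO.1]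
  rw [eX, eG] at hsob
  have hpow : volume S * volume S ^ (1 - 1 / p) = volume S ^ 2 * volume S ^ (-(1 / p)) := by
    conv_lhs => rw [← ENNReal.rpow_one (volume S), ← ENNReal.rpow_mul,
      ← ENNReal.rpow_add _ _ hS0 hStop]
    rw [← ENNReal.rpow_two, ← ENNReal.rpow_add _ _ hS0 hStop]
    congr 1; ring
  have hscale : ENNReal.ofReal (r * R) ^ 2 * volume S ^ (-(1 / p))
      = ENNReal.ofReal R ^ 2 * μ ^ (-(1 / p)) * ENNReal.ofReal (r ^ (2 - (n : ℝ) / p)) := by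
    rw [hSvol, ENNReal.mul_rpow_of_ne_top (by simp) hμtop, ENNReal.ofReal_mul hr.1.le, mul_pow,
      ENNReal.ofReal_rpow_of_pos (pow_pos hr.1 n), ← ENNReal.ofReal_pow hr.1.le]
    have : r ^ (2 - (n : ℝ) / p) = r ^ 2 * (r ^ n) ^ (-(1 / p)) := by
      rw [← Real.rpow_natCast r n, ← Real.rpow_mul hr.1.le, ← Real.rpow_natCast r 2,
        ← Real.rpow_add hr.1]
      congr 1; push_cast; ring
    rw [this, ENNReal.ofReal_mul (by positivity)]
    ring
  set X := ∫⁻ x in Ω ∩ Metric.ball x₀ ρ, h x ^ 2 * ‖v x k‖ₑ ^ 2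
  set A := ∫⁻ x in Ω, ‖Dv x‖ₑ ^ 2
  set W := ∫⁻ x in Ω, ‖v x‖ₑ ^ 2
  have hS2 : volume S ^ 2 ≠ 0 := pow_ne_zero 2 hS0
  have hS2top : volume S ^ 2 ≠ ⊤ := ENNReal.pow_ne_top hStop
  have hfin : volume S ^ 2 * X
      ≤ volume S ^ 2 * (ε * A + 2 / volume S * (volume Ω + N) * W) := by
    calc volume S ^ 2 * X ≤ _ := hsob
      _ ≤ 2 * (volume S * W * (volume Ω + N))
        + 2 * (ENNReal.ofReal (r * R) ^ 2 * (volume S * volume S ^ (1 - 1 / p))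
          * J ^ 2 * N ^ (1 / p) * A) := by gcongr
      _ = 2 * (volume S * W * (volume Ω + N))
        + volume S ^ 2 * (2 * ((ENNReal.ofReal (r * R) ^ 2 * volume S ^ (-(1 / p)))
          * J ^ 2 * N ^ (1 / p))) * A := by rw [hpow]; ring
      _ = 2 * (volume S * W * (volume Ω + N))
        + volume S ^ 2 * (K * ENNReal.ofReal (r ^ (2 - (n : ℝ) / p))) * A := by
          rw [hscale, hK]; ring
      _ ≤ 2 * (volume S * W * (volume Ω + N)) + volume S ^ 2 * ε * A := by gcongr
      _ = volume S * (volume S * (volume S)⁻¹) * (2 * (volume Ω + N) * W)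
          + volume S ^ 2 * ε * A := by rw [ENNReal.mul_inv_cancel hS0 hStop]; ring
      _ = _ := by rw [div_eq_mul_inv]; ring
  exact (ENNReal.mul_le_mul_iff_right hS2 hS2top).1 hfin

theorem enorm_sq_eq_sum (v : Vec m) : ‖v‖ₑ ^ 2 = ∑ k, ‖v k‖ₑ ^ 2 := by
  simp only [← ofReal_norm, ← ENNReal.ofReal_pow (norm_nonneg _)]
  rw [EuclideanSpace.norm_sq_eq, ENNReal.ofReal_sum_of_nonneg fun i _ => by positivity]

/-- Sobolev functions are square integrable with respect to weights in `L^p`, `p > n / 2`, with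
arbitrarily small contribution of the gradient. -/
theorem IsBoundedSmoothDomain.exists_weighted_bound (hΩ : IsBoundedSmoothDomain Ω) {p : ℝ}
    (hp1 : 1 < p) (hp : (n : ℝ) / 2 < p) {N : ℝ≥0∞} (hN : N ≠ ⊤) {ε : ℝ≥0∞} (hε : ε ≠ 0) :
    ∃ C : ℝ≥0∞, C ≠ ⊤ ∧ ∀ (v : Vec n → Vec m) (Dv : Vec n → Mat m n) (h : Vec n → ℝ≥0∞),
      MemW12 Ω v Dv → AEMeasurable h (volume.restrict Ω) → ∫⁻ x in Ω, h x ^ (2 * p) ≤ N →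
      ∫⁻ x in Ω, h x ^ 2 * ‖v x‖ₑ ^ 2
        ≤ ε * (∫⁻ x in Ω, ‖Dv x‖ₑ ^ 2) + C * ∫⁻ x in Ω, ‖v x‖ₑ ^ 2 := by
  have hΩm := hΩ.measurableSet
  have hcomp : IsCompact (closure Ω) := hΩ.isBounded.isCompact_closure
  have hmain : ∀ ε : ℝ≥0∞, ε ≠ 0 → ∃ C : ℝ≥0∞, C ≠ ⊤ ∧ ∀ (v : Vec n → Vec m)
      (Dv : Vec n → Mat m n) (h : Vec n → ℝ≥0∞), MemW12 Ω v Dv → Measurable h →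
      ∫⁻ x, h x ^ (2 * p) ≤ N → ∫⁻ x, h x ^ 2 ≤ volume Ω + N → ∀ k,
      ∫⁻ x in Ω ∩ closure Ω, h x ^ 2 * ‖v x k‖ₑ ^ 2
        ≤ ε * (∫⁻ x in Ω, ‖Dv x‖ₑ ^ 2) + C * ∫⁻ x in Ω, ‖v x‖ₑ ^ 2 := by
    -- The quantifier over `ε` is inside the induction predicate so that a union of two sets can use
    -- `ε / 2` on each.
    refine hcomp.induction_on (p := fun s => ∀ ε : ℝ≥0∞, ε ≠ 0 → ∃ C : ℝ≥0∞, C ≠ ⊤ ∧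
      ∀ (v : Vec n → Vec m) (Dv : Vec n → Mat m n) (h : Vec n → ℝ≥0∞), MemW12 Ω v Dv →
      Measurable h → ∫⁻ x, h x ^ (2 * p) ≤ N → ∫⁻ x, h x ^ 2 ≤ volume Ω + N → ∀ k,
      ∫⁻ x in Ω ∩ s, h x ^ 2 * ‖v x k‖ₑ ^ 2
        ≤ ε * (∫⁻ x in Ω, ‖Dv x‖ₑ ^ 2) + C * ∫⁻ x in Ω, ‖v x‖ₑ ^ 2) ?_ ?_ ?_ ?_
    · exact fun ε hε => ⟨0, by simp, fun v Dv h _ _ _ _ k => by simp⟩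
    · intro s t hst ht ε hε
      obtain ⟨C, hC, h⟩ := ht ε hε
      exact ⟨C, hC, fun v Dv w hv h1 h2 h3 k =>
        (lintegral_mono_set (inter_subset_inter_right Ω hst)).trans (h v Dv w hv h1 h2 h3 k)⟩
    · intro s t hs ht ε hε
      obtain ⟨C, hC, h⟩ := hs (ε / 2) (ENNReal.half_pos hε).ne'
      obtain ⟨C', hC', h'⟩ := ht (ε / 2) (ENNReal.half_pos hε).ne'
      refine ⟨C + C', ENNReal.add_ne_top.2 ⟨hC, hC'⟩, fun v Dv w hv h1 h2 h3 k => ?_⟩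
      rw [inter_union_distrib_left]
      refine (lintegral_union_le _ _ _).trans
        ((add_le_add (h v Dv w hv h1 h2 h3 k) (h' v Dv w hv h1 h2 h3 k)).trans (le_of_eq ?_))
      conv_rhs => rw [← ENNReal.add_halves ε]
      ring
    · intro x₀ hx₀
      obtain ⟨s, hs, h⟩ := hΩ.exists_local_weighted_bound (m := m) hp1 hp hN hx₀
      exact ⟨s, mem_nhdsWithin_of_mem_nhds hs, h⟩
  have hm0 : ((m : ℝ≥0∞) + 1) ≠ 0 := by simp
  have hmtop : ((m : ℝ≥0∞) + 1) ≠ ⊤ := by simp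
  -- The `m` component estimates are added up; `m + 1` avoids dividing by zero when `m = 0`.
  obtain ⟨C, hC, hmain⟩ := hmain (ε / (m + 1)) (ENNReal.div_ne_zero.2 ⟨hε, hmtop⟩)
  refine ⟨m * C, ENNReal.mul_ne_top (by simp) hC, fun v Dv h hv hh hhp => ?_⟩
  set h' : Vec n → ℝ≥0∞ := Ω.indicator (hh.mk h) with hh'
  have hh'm : Measurable h' := hh.measurable_mk.indicator hΩm
  have hae : h' =ᵐ[volume] Ω.indicator h :=
    (ae_eq_restrict_iff_indicator_ae_eq hΩm).1 hh.ae_eq_mk.symm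
  have e1 : ∫⁻ x, h' x ^ (2 * p) ≤ N := by
    rw [lintegral_eq_setLIntegral_of_ae_eq_indicator hΩm hae (F := fun y => y ^ (2 * p))
      (ENNReal.zero_rpow_of_pos (by linarith))]
    exact hhp
  have e2 : ∫⁻ x, h' x ^ 2 ≤ volume Ω + N := by
    rw [lintegral_eq_setLIntegral_of_ae_eq_indicator hΩm hae (F := fun y => y ^ 2) (by simp)]
    calc ∫⁻ x in Ω, h x ^ 2 ≤ ∫⁻ x in Ω, (1 + h x ^ (2 * p)) := by
          refine lintegral_mono fun x => ?_
          have := ENNReal.le_one_add_rpow (h x ^ 2) hp1.le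
          rwa [← ENNReal.rpow_two, ← ENNReal.rpow_mul, ENNReal.rpow_two] at this
      _ = volume Ω + ∫⁻ x in Ω, h x ^ (2 * p) := by
          rw [lintegral_add_left measurable_const]; simp
      _ ≤ _ := by gcongr
  have e3 : ∀ k, ∫⁻ x in Ω, h' x ^ 2 * ‖v x k‖ₑ ^ 2
      ≤ ε / (m + 1) * (∫⁻ x in Ω, ‖Dv x‖ₑ ^ 2) + C * ∫⁻ x in Ω, ‖v x‖ₑ ^ 2 := fun k => by
    have := hmain v Dv h' hv hh'm e1 e2 k
    rwa [inter_eq_left.2 subset_closure] at this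
  have hvm : ∀ k, AEMeasurable (fun x => h' x ^ 2 * ‖v x k‖ₑ ^ 2) (volume.restrict Ω) := fun k =>
    (hh'm.pow_const 2).aemeasurable.mul (((EuclideanSpace.proj k :
      Vec m →L[ℝ] ℝ).continuous.measurable.comp_aemeasurable
        hv.memLp.1.aemeasurable).enorm.pow_const 2)
  calc ∫⁻ x in Ω, h x ^ 2 * ‖v x‖ₑ ^ 2 = ∫⁻ x in Ω, ∑ k, h' x ^ 2 * ‖v x k‖ₑ ^ 2 := by
        refine lintegral_congr_ae ?_
        filter_upwards [ae_restrict_of_ae hae, ae_restrict_mem hΩm] with x hx hxΩ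
        rw [hx, indicator_of_mem hxΩ, enorm_sq_eq_sum, Finset.mul_sum]
    _ = ∑ k, ∫⁻ x in Ω, h' x ^ 2 * ‖v x k‖ₑ ^ 2 := lintegral_finsetSum' _ fun k _ => hvm k
    _ ≤ ∑ _k : Fin m, (ε / (m + 1) * (∫⁻ x in Ω, ‖Dv x‖ₑ ^ 2)
        + C * ∫⁻ x in Ω, ‖v x‖ₑ ^ 2) := Finset.sum_le_sum fun k _ => e3 k
    _ = m * (ε / (m + 1)) * (∫⁻ x in Ω, ‖Dv x‖ₑ ^ 2) + m * C * ∫⁻ x in Ω, ‖v x‖ₑ ^ 2 := by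
        rw [Finset.sum_const, Finset.card_univ, Fintype.card_fin, nsmul_eq_mul]; ring
    _ ≤ _ := by
        gcongr
        calc (m : ℝ≥0∞) * (ε / (m + 1)) ≤ (m + 1) * (ε / (m + 1)) := by gcongr; exact le_self_add
          _ = ε := ENNReal.mul_div_cancel hm0 hmtop

end WeightedSobolev

/-! ### Differences in the energy space -/

section EnergySpace

variable {m n : ℕ} {Ω : Set (Vec n)}

theorem MemEnergySpace.memW12 {bc : BoundaryCondition} {v : Vec n → Vec m} {Dv : Vec n → Mat m n}
    (h : MemEnergySpace bc Ω v Dv) : MemW12 Ω v Dv := by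
  cases bc
  · exact MemW12Zero.toMemW12 h
  · exact h

theorem MemW12.sub (hΩ : volume Ω ≠ ⊤) {v₁ v₂ : Vec n → Vec m} {Dv₁ Dv₂ : Vec n → Mat m n}
    (h₁ : MemW12 Ω v₁ Dv₁) (h₂ : MemW12 Ω v₂ Dv₂) :
    MemW12 Ω (fun x => v₁ x - v₂ x) (fun x => Dv₁ x - Dv₂ x) := by
  refine ⟨h₁.memLp.sub h₂.memLp, h₁.memLp_grad.sub h₂.memLp_grad, fun φ hφ k i => ?_⟩
  have : IsFiniteMeasure (volume.restrict Ω) := ⟨by simpa using hΩ.lt_top⟩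
  have hbd : ∀ ψ : Vec n → ℝ, Continuous ψ → HasCompactSupport ψ → ∀ f : Vec n → ℝ,
      Integrable f (volume.restrict Ω) → Integrable (fun x => f x * ψ x) (volume.restrict Ω) :=
    fun ψ hψ hψs f hf => by
      obtain ⟨M, hM⟩ := hψs.exists_bound_of_continuous hψ
      exact hf.mul_bdd hψ.aestronglyMeasurable (ae_of_all _ hM)
  have hpc : Continuous (partialDeriv i φ) :=
    (hφ.1.continuous_fderiv (by simp)).clm_apply continuous_const
  have hps : HasCompactSupport (partialDeriv i φ) := hφ.2.1.fderiv_apply (𝕜 := ℝ) _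
  have hv : ∀ {v : Vec n → Vec m} {Dv : Vec n → Mat m n}, MemW12 Ω v Dv →
      Integrable (fun x => v x k * partialDeriv i φ x) (volume.restrict Ω) ∧
      Integrable (fun x => Dv x (k, i) * φ x) (volume.restrict Ω) := fun h =>
    ⟨hbd _ hpc hps _ ((EuclideanSpace.proj k : Vec m →L[ℝ] ℝ).integrable_comp
        (h.memLp.integrable (by norm_num))),
      hbd _ hφ.1.continuous hφ.2.1 _ ((EuclideanSpace.proj (k, i) : Mat m n →L[ℝ] ℝ).integrable_comp
        (h.memLp_grad.integrable (by norm_num)))⟩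
  simp only [PiLp.sub_apply, sub_mul]
  rw [integral_sub (hv h₁).1 (hv h₂).1, integral_sub (hv h₁).2 (hv h₂).2,
    h₁.weak_grad φ hφ k i, h₂.weak_grad φ hφ k i]
  ring

theorem IsTestFunction.sub {G : Type*} [NormedAddCommGroup G] [NormedSpace ℝ G]
    {φ ψ : Vec n → G} (hφ : IsTestFunction Ω φ) (hψ : IsTestFunction Ω ψ) :
    IsTestFunction Ω fun x => φ x - ψ x :=
  ⟨hφ.1.sub hψ.1, hφ.2.1.sub hψ.2.1,
    (tsupport_sub _ _).trans (union_subset hφ.2.2 hψ.2.2)⟩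

theorem gradMat_sub {φ ψ : Vec n → Vec m} (hφ : ContDiff ℝ ∞ φ) (hψ : ContDiff ℝ ∞ ψ)
    (x : Vec n) : gradMat (fun x => φ x - ψ x) x = gradMat φ x - gradMat ψ x := by
  ext ki
  have : fderiv ℝ (fun x => φ x - ψ x) x = fderiv ℝ φ x - fderiv ℝ ψ x :=
    fderiv_fun_sub (hφ.differentiable (by simp) x) (hψ.differentiable (by simp) x)
  simp [gradMat, partialDeriv, this]

theorem tendsto_eLpNorm_sub_sub {E : Type*} [NormedAddCommGroup E] {μ : Measure (Vec n)}
    {f g : ℕ → Vec n → E} {F G : Vec n → E} (hf : ∀ j, AEStronglyMeasurable (f j) μ)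
    (hg : ∀ j, AEStronglyMeasurable (g j) μ) (hF : AEStronglyMeasurable F μ)
    (hG : AEStronglyMeasurable G μ)
    (h₁ : Tendsto (fun j => eLpNorm (fun x => f j x - F x) 2 μ) atTop (𝓝 0))
    (h₂ : Tendsto (fun j => eLpNorm (fun x => g j x - G x) 2 μ) atTop (𝓝 0)) :
    Tendsto (fun j => eLpNorm (fun x => (f j x - g j x) - (F x - G x)) 2 μ) atTop (𝓝 0) := by
  have h := h₁.add h₂
  rw [add_zero] at h
  refine tendsto_of_tendsto_of_tendsto_of_le_of_le tendsto_const_nhds h (fun _ => zero_le) fun j => ?_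
  have := eLpNorm_sub_le ((hf j).sub hF) ((hg j).sub hG) (p := 2) (by norm_num)
  refine le_trans (le_of_eq ?_) this
  congr 1
  funext x
  simp only [Pi.sub_apply]
  abel

theorem continuous_gradMat {φ : Vec n → Vec m} (hφ : ContDiff ℝ ∞ φ) : Continuous (gradMat φ) := by
  refine (PiLp.continuous_toLp 2 _).comp (continuous_pi fun ki => ?_)
  exact (EuclideanSpace.proj ki.1 : Vec m →L[ℝ] ℝ).continuous.comp
    ((hφ.continuous_fderiv (by simp)).clm_apply continuous_const)

theorem MemW12Zero.sub (hΩ : volume Ω ≠ ⊤) {v₁ v₂ : Vec n → Vec m} {Dv₁ Dv₂ : Vec n → Mat m n}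
    (h₁ : MemW12Zero Ω v₁ Dv₁) (h₂ : MemW12Zero Ω v₂ Dv₂) :
    MemW12Zero Ω (fun x => v₁ x - v₂ x) (fun x => Dv₁ x - Dv₂ x) := by
  refine ⟨h₁.toMemW12.sub hΩ h₂.toMemW12, ?_⟩
  obtain ⟨φ, hφ, hφ1, hφ2⟩ := h₁.approx
  obtain ⟨ψ, hψ, hψ1, hψ2⟩ := h₂.approx
  refine ⟨fun j x => φ j x - ψ j x, fun j => (hφ j).sub (hψ j), ?_, ?_⟩
  · exact tendsto_eLpNorm_sub_sub (fun j => (hφ j).1.continuous.aestronglyMeasurable)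
      (fun j => (hψ j).1.continuous.aestronglyMeasurable) h₁.memLp.1 h₂.memLp.1 hφ1 hψ1
  · have hg : ∀ j x, gradMat (fun x => φ j x - ψ j x) x = gradMat (φ j) x - gradMat (ψ j) x :=
      fun j x => gradMat_sub (hφ j).1 (hψ j).1 x
    simp only [hg]
    exact tendsto_eLpNorm_sub_sub (fun j => (continuous_gradMat (hφ j).1).aestronglyMeasurable)
      (fun j => (continuous_gradMat (hψ j).1).aestronglyMeasurable) h₁.memLp_grad.1
      h₂.memLp_grad.1 hφ2 hψ2

/-- Makes the difference of two solutions at a fixed time an admissible test function for either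
boundary condition. -/
theorem MemEnergySpace.sub (hΩ : volume Ω ≠ ⊤) {bc : BoundaryCondition} {v₁ v₂ : Vec n → Vec m}
    {Dv₁ Dv₂ : Vec n → Mat m n} (h₁ : MemEnergySpace bc Ω v₁ Dv₁)
    (h₂ : MemEnergySpace bc Ω v₂ Dv₂) :
    MemEnergySpace bc Ω (fun x => v₁ x - v₂ x) (fun x => Dv₁ x - Dv₂ x) := by
  cases bc
  · exact MemW12Zero.sub hΩ h₁ h₂
  · exact MemW12.sub hΩ h₁ h₂

end EnergySpace

/-! ### Weak solutions as curves in `L²` and their energy bound -/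

section WeakSolution

variable {m n : ℕ} {Ω : Set (Vec n)} {T₀ : ℝ} {bc : BoundaryCondition}
  {A : Vec m → Mat m n → Mat m n} {F : Vec m → Mat m n → Vec m} {U₀ : Vec n → Vec m}

theorem L2_inner_eq_integral {α E : Type*} [MeasurableSpace α] {μ : Measure α}
    [NormedAddCommGroup E] [InnerProductSpace ℝ E] {f g : Lp E 2 μ} {f' g' : α → E}
    (hf : f =ᵐ[μ] f') (hg : g =ᵐ[μ] g') : ⟪f, g⟫_ℝ = ∫ x, ⟪f' x, g' x⟫_ℝ ∂μ := by
  rw [L2.inner_def]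
  refine integral_congr_ae ?_
  filter_upwards [hf, hg] with x hx hx'
  rw [hx, hx']

theorem MeasureTheory.MemLp.integrable_real_inner {α E : Type*} [MeasurableSpace α]
    {μ : Measure α} [NormedAddCommGroup E] [InnerProductSpace ℝ E] {f g : α → E}
    (hf : MemLp f 2 μ) (hg : MemLp g 2 μ) : Integrable (fun x => ⟪f x, g x⟫_ℝ) μ :=
  (hf.norm.integrable_mul hg.norm).mono' (hf.1.inner hg.1)
    (ae_of_all _ fun _ => norm_inner_le_norm _ _)

/-- A weak solution as a curve of square integrable functions. -/
theorem IsWeakSolution.exists_curves {u : ℝ → Vec n → Vec m} {Du : ℝ → Vec n → Mat m n}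
    (hu : IsWeakSolution A F bc Ω T₀ U₀ u Du) :
    ∃ (U f : ℝ → Lp (Vec m) 2 (volume.restrict Ω)) (D a : ℝ → Lp (Mat m n) 2 (volume.restrict Ω)),
      MemLp U 2 (volume.restrict (Ioo 0 T₀)) ∧ MemLp f 2 (volume.restrict (Ioo 0 T₀)) ∧
      MemLp D 2 (volume.restrict (Ioo 0 T₀)) ∧ MemLp a 2 (volume.restrict (Ioo 0 T₀)) ∧
      (∀ᵐ t ∂(volume.restrict (Ioo 0 T₀)), U t =ᵐ[volume.restrict Ω] u t ∧
        (f t =ᵐ[volume.restrict Ω] fun x => F (u t x) (Du t x)) ∧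
        D t =ᵐ[volume.restrict Ω] Du t ∧
        (a t =ᵐ[volume.restrict Ω] fun x => A (u t x) (Du t x))) ∧
      ∀ (v : Vec n → Vec m) (Dv : Vec n → Mat m n), MemEnergySpace bc Ω v Dv →
        ∀ (v' : Lp (Vec m) 2 (volume.restrict Ω)) (d' : Lp (Mat m n) 2 (volume.restrict Ω)),
        v' =ᵐ[volume.restrict Ω] v → d' =ᵐ[volume.restrict Ω] Dv →
        ∀ θ : ℝ → ℝ, ContDiff ℝ ∞ θ → HasCompactSupport θ → tsupport θ ⊆ Iio T₀ →
        -(∫ t in Ioo 0 T₀, deriv θ t * ⟪U t, v'⟫_ℝ) + ∫ t in Ioo 0 T₀, θ t * ⟪a t, d'⟫_ℝ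
          = θ 0 * (∫ x in Ω, ⟪U₀ x, v x⟫_ℝ) + ∫ t in Ioo 0 T₀, θ t * ⟪f t, v'⟫_ℝ := by
  obtain ⟨U, hUL, hU⟩ := exists_memLp_curve hu.memLp
  obtain ⟨D, hDL, hD⟩ := exists_memLp_curve hu.memLp_grad
  obtain ⟨a, haL, ha⟩ := exists_memLp_curve (G := fun t x => A (u t x) (Du t x)) hu.memLp_flux
  obtain ⟨f, hfL, hf⟩ := exists_memLp_curve (G := fun t x => F (u t x) (Du t x)) hu.memLp_reaction
  refine ⟨U, f, D, a, hUL, hfL, hDL, haL, ?_, fun v Dv hv v' d' hv' hd' θ h1 h2 h3 => ?_⟩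
  · filter_upwards [hU, hD, ha, hf] with t h1 h2 h3 h4 using ⟨h1, h4, h2, h3⟩
  · rw [integral_congr_ae (g := fun t => deriv θ t * ∫ x in Ω, ⟪u t x, v x⟫_ℝ) (by
        filter_upwards [hU] with t ht
        rw [L2_inner_eq_integral ht hv']),
      integral_congr_ae (f := fun t => θ t * ⟪a t, d'⟫_ℝ)
        (g := fun t => θ t * ∫ x in Ω, ⟪A (u t x) (Du t x), Dv x⟫_ℝ) (by
        filter_upwards [ha] with t ht
        rw [L2_inner_eq_integral ht hd']),
      integral_congr_ae (f := fun t => θ t * ⟪f t, v'⟫_ℝ)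
        (g := fun t => θ t * ∫ x in Ω, ⟪F (u t x) (Du t x), v x⟫_ℝ) (by
        filter_upwards [hf] with t ht
        rw [L2_inner_eq_integral ht hv'])]
    exact hu.weak_form v Dv hv θ h1 h2 h3

theorem lintegral_enorm_sq_eq_ofReal_inner {α E : Type*} [MeasurableSpace α] {μ : Measure α}
    [NormedAddCommGroup E] [InnerProductSpace ℝ E] {f : Lp E 2 μ} {f' : α → E}
    (hf : f =ᵐ[μ] f') : ∫⁻ x, ‖f' x‖ₑ ^ 2 ∂μ = ENNReal.ofReal ⟪f, f⟫_ℝ := by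
  have hf' : MemLp f' 2 μ := (Lp.memLp f).ae_eq hf
  rw [L2_inner_eq_integral hf hf, ofReal_integral_eq_lintegral_ofReal
    (hf'.integrable_real_inner hf') (ae_of_all _ fun x => real_inner_self_nonneg)]
  refine lintegral_congr fun x => ?_
  rw [real_inner_self_eq_norm_sq, ENNReal.ofReal_pow (norm_nonneg _), ofReal_norm]

/-- A weak solution is bounded in time with values in `L²`. -/
theorem IsWeakSolution.exists_energy_bound {u : ℝ → Vec n → Vec m} {Du : ℝ → Vec n → Mat m n}
    (hT₀ : 0 < T₀) (hu : IsWeakSolution A F bc Ω T₀ U₀ u Du) :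
    ∃ M : ℝ≥0∞, M ≠ ⊤ ∧ ∀ᵐ t ∂(volume.restrict (Ioo 0 T₀)), ∫⁻ x in Ω, ‖u t x‖ₑ ^ 2 ≤ M := by
  obtain ⟨U, f, D, a, hU, hf, hD, ha, hae, hweak⟩ := hu.exists_curves
  -- Cutoffs supported in the open interval vanish at `0`, which removes the initial datum of a
  -- single solution.
  have hid := fun χ => energy_identity (I := Ioo 0 T₀) hU hf hD ha (by
    filter_upwards [hae, hu.mem_energySpace] with s hs hsV θ h1 h2 h3
    have := hweak _ _ hsV (U s) (D s) hs.1 hs.2.2.1 θ h1 h2 (h3.trans fun t ht => ht.2)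
    rwa [image_eq_zero_of_notMem_tsupport fun h0 => lt_irrefl _ (h3 h0).1, zero_mul,
      zero_add] at this) (χ := χ)
  have he := hU.integrable_real_inner hU
  have h1 := ha.integrable_real_inner hD
  have h2 := hf.integrable_real_inner hU
  -- The energy `|U(t)|²` has an integrable weak derivative, namely `-l`, so it is bounded in time
  -- although it was only known to be integrable.
  obtain ⟨M, hM⟩ := exists_ae_bound_of_integral_deriv_mul hT₀ (e := fun t => ⟪U t, U t⟫_ℝ)
    (l := fun t => 2 * (⟪a t, D t⟫_ℝ - ⟪f t, U t⟫_ℝ)) he ((h1.sub h2).const_mul 2)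
    (fun η hη hηs hηT => by
      rw [integral_deriv_mul_eq_of_quadratic (l := fun t => ⟪a t, D t⟫_ℝ - ⟪f t, U t⟫_ℝ) he
        (h1.sub h2) (fun χ hχ hχs hχT => ?_) hη hηs hηT, ← integral_const_mul]
      · refine integral_congr_ae (ae_of_all _ fun t => ?_)
        simp only; ring
      · have := hid χ hχ hχs hχT
        have k1 := IntegrableOn.continuous_mul_of_hasCompactSupport h1
          (hχ.continuous.mul hχ.continuous) hχs.mul_left
        have k2 := IntegrableOn.continuous_mul_of_hasCompactSupport h2
          (hχ.continuous.mul hχ.continuous) hχs.mul_left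
        have k3 : ∫ t in Ioo 0 T₀, χ t * χ t * (⟪a t, D t⟫_ℝ - ⟪f t, U t⟫_ℝ)
            = (∫ t in Ioo 0 T₀, χ t * χ t * ⟪a t, D t⟫_ℝ)
              - ∫ t in Ioo 0 T₀, χ t * χ t * ⟪f t, U t⟫_ℝ := by
          simp only [mul_sub]
          exact integral_sub k1 k2
        rw [k3]; linarith)
  refine ⟨ENNReal.ofReal M, ENNReal.ofReal_ne_top, ?_⟩
  filter_upwards [hM, hae] with t ht hs
  rw [lintegral_enorm_sq_eq_ofReal_inner hs.1]
  exact ENNReal.ofReal_le_ofReal ((le_abs_self _).trans ht)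

end WeakSolution

/-! ### Structure estimate and uniqueness -/

section Uniqueness

variable {m n : ℕ} {Ω : Set (Vec n)} {T₀ : ℝ} {bc : BoundaryCondition}
  {A : Vec m → Mat m n → Mat m n} {F : Vec m → Mat m n → Vec m} {U₀ : Vec n → Vec m}

theorem MeasureTheory.MemLp.ae_memLp_section {X Y E : Type*} [MeasurableSpace X]
    [MeasurableSpace Y] [NormedAddCommGroup E] [SecondCountableTopology E] [CompleteSpace E]
    {μ : Measure X} {ν : Measure Y} [SFinite μ] [SFinite ν] [IsSeparable ν] {g : X × Y → E}
    (hg : MemLp g 2 (μ.prod ν)) : ∀ᵐ t ∂μ, MemLp (fun x => g (t, x)) 2 ν := by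
  obtain ⟨W, -, hW⟩ := exists_memLp_curve (G := fun t x => g (t, x)) hg
  filter_upwards [hW] with t ht using (Lp.memLp (W t)).ae_eq ht

/-- A weak solution whose gradient is bounded in time with values in `L^q`, `q > n`, is bounded. -/
theorem IsWeakSolution.exists_norm_bound (hΩ : IsBoundedSmoothDomain Ω) (hT₀ : 0 < T₀)
    {u : ℝ → Vec n → Vec m} {Du : ℝ → Vec n → Mat m n} (hu : IsWeakSolution A F bc Ω T₀ U₀ u Du)
    {q : ℝ} (hq1 : 1 < q) (hq : (n : ℝ) < q) {N : ℝ≥0∞} (hN : N ≠ ⊤)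
    (hbound : ∀ᵐ t ∂(volume.restrict (Ioo 0 T₀)), ∫⁻ x in Ω, ‖Du t x‖ₑ ^ q ≤ N) :
    ∃ B : ℝ, ∀ᵐ t ∂(volume.restrict (Ioo 0 T₀)), ∀ᵐ x ∂(volume.restrict Ω), ‖u t x‖ ≤ B := by
  obtain ⟨M, hM, hMu⟩ := hu.exists_energy_bound hT₀
  obtain ⟨B, hB, hBu⟩ := hΩ.exists_sup_bound (m := m) hq1 hq hM hN
  have hmB : (m : ℝ≥0∞) * B ^ 2 ≠ ⊤ := ENNReal.mul_ne_top (by simp) (ENNReal.pow_ne_top hB)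
  refine ⟨√((m : ℝ≥0∞) * B ^ 2).toReal, ?_⟩
  filter_upwards [hMu, hbound, hu.mem_energySpace] with t h1 h2 h3
  filter_upwards [hBu _ _ h3.memW12 h1 h2] with x hx
  refine Real.le_sqrt_of_sq_le ?_
  have h4 : ‖u t x‖ₑ ^ 2 ≤ m * B ^ 2 := by
    rw [enorm_sq_eq_sum]
    calc ∑ k, ‖u t x k‖ₑ ^ 2 ≤ ∑ _k : Fin m, B ^ 2 := Finset.sum_le_sum fun k _ => by
          have := hx k
          gcongr
      _ = _ := by simp
  have h5 := ENNReal.toReal_mono hmB h4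
  rwa [ENNReal.toReal_pow, toReal_enorm] at h5

/-- The pointwise structure estimate for the difference of two solutions. -/
theorem inner_sub_inner_le_of_structure {lam κ : ℝ} (hlam : 0 < lam) (hκ : 0 ≤ κ)
    (hmono : ∀ (u : Vec m) (ζ₁ ζ₂ : Mat m n),
      lam * ‖ζ₁ - ζ₂‖ ^ 2 ≤ ⟪A u ζ₁ - A u ζ₂, ζ₁ - ζ₂⟫_ℝ)
    {u₁ u₂ : Vec m} {ζ₁ ζ₂ : Mat m n}
    (hA : ‖A u₁ ζ₂ - A u₂ ζ₂‖ ≤ κ * ‖u₁ - u₂‖ * ‖ζ₂‖)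
    (hF : ‖F u₁ ζ₁ - F u₂ ζ₂‖ ≤ κ * (‖u₁ - u₂‖ * ‖ζ₂‖ + ‖ζ₁ - ζ₂‖)) :
    ⟪F u₁ ζ₁ - F u₂ ζ₂, u₁ - u₂⟫_ℝ - ⟪A u₁ ζ₁ - A u₂ ζ₂, ζ₁ - ζ₂⟫_ℝ
      ≤ -(lam / 2) * ‖ζ₁ - ζ₂‖ ^ 2 + (κ + κ ^ 2 / lam) * (‖ζ₂‖ ^ 2 * ‖u₁ - u₂‖ ^ 2)
        + (κ + κ ^ 2 / lam) * ‖u₁ - u₂‖ ^ 2 := by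
  have h1 := hmono u₁ ζ₁ ζ₂
  have h2 : -(κ * ‖u₁ - u₂‖ * ‖ζ₂‖ * ‖ζ₁ - ζ₂‖) ≤ ⟪A u₁ ζ₂ - A u₂ ζ₂, ζ₁ - ζ₂⟫_ℝ := by
    have h3 := abs_real_inner_le_norm (A u₁ ζ₂ - A u₂ ζ₂) (ζ₁ - ζ₂)
    have h4 := mul_le_mul_of_nonneg_right hA (norm_nonneg (ζ₁ - ζ₂))
    linarith [neg_abs_le ⟪A u₁ ζ₂ - A u₂ ζ₂, ζ₁ - ζ₂⟫_ℝ]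
  -- Passing through `A u₁ ζ₂` puts the `u`-variation at `ζ₂`, so only the second gradient acts as a
  -- weight.
  have h5 : ⟪A u₁ ζ₁ - A u₂ ζ₂, ζ₁ - ζ₂⟫_ℝ
      = ⟪A u₁ ζ₁ - A u₁ ζ₂, ζ₁ - ζ₂⟫_ℝ + ⟪A u₁ ζ₂ - A u₂ ζ₂, ζ₁ - ζ₂⟫_ℝ := by
    rw [← inner_add_left, sub_add_sub_cancel]
  have h6 : ⟪F u₁ ζ₁ - F u₂ ζ₂, u₁ - u₂⟫_ℝ
      ≤ κ * (‖u₁ - u₂‖ * ‖ζ₂‖ + ‖ζ₁ - ζ₂‖) * ‖u₁ - u₂‖ :=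
    (real_inner_le_norm _ _).trans (mul_le_mul_of_nonneg_right hF (norm_nonneg _))
  set w := ‖u₁ - u₂‖
  set d := ‖ζ₁ - ζ₂‖
  set h := ‖ζ₂‖
  -- Used once for `A` and once for `F`; each use spends a quarter of `lam`, leaving half of the
  -- coercivity.
  have young : ∀ y : ℝ, κ * y * d ≤ lam / 4 * d ^ 2 + κ ^ 2 / lam * y ^ 2 := by
    intro y
    have e : lam / 4 * d ^ 2 + κ ^ 2 / lam * y ^ 2 - κ * y * d
        = (lam * d / 2 - κ * y) ^ 2 / lam := by field_simp; ring
    have : 0 ≤ (lam * d / 2 - κ * y) ^ 2 / lam := by positivity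
    linarith
  have y1 := young w
  have y2 := young (w * h)
  have y3 : κ * (w ^ 2 * h) ≤ κ * (w ^ 2 * h ^ 2 + w ^ 2) := by
    refine mul_le_mul_of_nonneg_left ?_ hκ
    nlinarith [sq_nonneg w, mul_nonneg (sq_nonneg w) (sq_nonneg (h - 1 / 2))]
  rw [h5]
  nlinarith

/-- The structure estimate integrated over the domain. -/
theorem integral_inner_sub_le {w f : Vec n → Vec m} {Dw a : Vec n → Mat m n} {h : Vec n → ℝ}
    {lam c ε C : ℝ} (hw : MemLp w 2 (volume.restrict Ω)) (hDw : MemLp Dw 2 (volume.restrict Ω))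
    (hf : MemLp f 2 (volume.restrict Ω)) (ha : MemLp a 2 (volume.restrict Ω))
    (hh : AEStronglyMeasurable h (volume.restrict Ω)) (hc : 0 ≤ c) (hε : 0 ≤ ε) (hC : 0 ≤ C)
    (hcε : c * ε ≤ lam / 2)
    (hpt : ∀ᵐ x ∂(volume.restrict Ω), ⟪f x, w x⟫_ℝ - ⟪a x, Dw x⟫_ℝ
      ≤ -(lam / 2) * ‖Dw x‖ ^ 2 + c * (h x ^ 2 * ‖w x‖ ^ 2) + c * ‖w x‖ ^ 2)
    (hweight : ∫⁻ x in Ω, ‖h x‖ₑ ^ 2 * ‖w x‖ₑ ^ 2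
      ≤ ENNReal.ofReal ε * (∫⁻ x in Ω, ‖Dw x‖ₑ ^ 2) + ENNReal.ofReal C * ∫⁻ x in Ω, ‖w x‖ₑ ^ 2) :
    (∫ x in Ω, ⟪f x, w x⟫_ℝ) - ∫ x in Ω, ⟪a x, Dw x⟫_ℝ
      ≤ (c * C + c) * ∫ x in Ω, ⟪w x, w x⟫_ℝ := by
  have hsq : ∀ {E : Type} [NormedAddCommGroup E] {g : Vec n → E}, MemLp g 2 (volume.restrict Ω) →
      Integrable (fun x => ‖g x‖ ^ 2) (volume.restrict Ω) ∧
      ∫⁻ x in Ω, ‖g x‖ₑ ^ 2 = ENNReal.ofReal (∫ x in Ω, ‖g x‖ ^ 2) := by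
    intro E _ g hg
    have h1 : Integrable (fun x => ‖g x‖ ^ 2) (volume.restrict Ω) := hg.integrable_norm_pow (by simp)
    refine ⟨h1, ?_⟩
    rw [ofReal_integral_eq_lintegral_ofReal h1 (ae_of_all _ fun x => by positivity)]
    refine lintegral_congr fun x => ?_
    rw [ENNReal.ofReal_pow (norm_nonneg _), ofReal_norm]
  obtain ⟨iw, ew⟩ := hsq hw
  obtain ⟨iD, eD⟩ := hsq hDw
  have hD0 : 0 ≤ ∫ x in Ω, ‖Dw x‖ ^ 2 := integral_nonneg fun x => by positivity
  have hw0 : 0 ≤ ∫ x in Ω, ‖w x‖ ^ 2 := integral_nonneg fun x => by positivity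
  rw [ew, eD, ← ENNReal.ofReal_mul hε, ← ENNReal.ofReal_mul hC,
    ← ENNReal.ofReal_add (mul_nonneg hε hD0) (mul_nonneg hC hw0)] at hweight
  have hm : AEStronglyMeasurable (fun x => h x ^ 2 * ‖w x‖ ^ 2) (volume.restrict Ω) :=
    (hh.pow 2).mul (hw.1.norm.pow 2)
  have he : ∀ x, ENNReal.ofReal (h x ^ 2 * ‖w x‖ ^ 2) = ‖h x‖ₑ ^ 2 * ‖w x‖ₑ ^ 2 := fun x => by
    rw [ENNReal.ofReal_mul (by positivity), ← sq_abs, ENNReal.ofReal_pow (abs_nonneg _),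
      ENNReal.ofReal_pow (norm_nonneg _), ofReal_norm, ← Real.norm_eq_abs, ofReal_norm]
  -- Finiteness of the weighted integral is itself a consequence of the weighted estimate.
  have ih : Integrable (fun x => h x ^ 2 * ‖w x‖ ^ 2) (volume.restrict Ω) := by
    refine ⟨hm, ?_⟩
    rw [hasFiniteIntegral_iff_ofReal (ae_of_all _ fun x => by positivity)]
    simp only [he]
    exact hweight.trans_lt ENNReal.ofReal_lt_top
  have hint : ∫ x in Ω, h x ^ 2 * ‖w x‖ ^ 2
      ≤ ε * (∫ x in Ω, ‖Dw x‖ ^ 2) + C * ∫ x in Ω, ‖w x‖ ^ 2 := by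
    rw [integral_eq_lintegral_of_nonneg_ae (ae_of_all _ fun x => by positivity) hm]
    simp only [he]
    exact ENNReal.toReal_le_of_le_ofReal (by positivity) hweight
  have j1 := hf.integrable_real_inner hw
  have j2 := ha.integrable_real_inner hDw
  rw [← integral_sub j1 j2]
  have hle := integral_mono_ae (j1.sub j2)
    (((iD.const_mul (-(lam / 2))).add (ih.const_mul c)).add (iw.const_mul c)) hpt
  have hsplit : ∫ x in Ω, (-(lam / 2) * ‖Dw x‖ ^ 2 + c * (h x ^ 2 * ‖w x‖ ^ 2) + c * ‖w x‖ ^ 2)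
      = -(lam / 2) * (∫ x in Ω, ‖Dw x‖ ^ 2) + c * (∫ x in Ω, h x ^ 2 * ‖w x‖ ^ 2)
        + c * ∫ x in Ω, ‖w x‖ ^ 2 := by
    have s1 := integral_add ((iD.const_mul (-(lam / 2))).add (ih.const_mul c)) (iw.const_mul c)
    have s2 := integral_add (iD.const_mul (-(lam / 2))) (ih.const_mul c)
    simp only [integral_const_mul] at s1 s2
    rw [← s2]
    exact s1
  simp only [real_inner_self_eq_norm_sq]
  refine hle.trans (hsplit.le.trans ?_)
  have k1 := mul_le_mul_of_nonneg_left hint hc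
  have k2 := mul_le_mul_of_nonneg_right hcε hD0
  nlinarith

/-- Two weak solutions with the structure estimate integrated over the domain coincide. -/
theorem IsWeakSolution.ae_eq_of_structure (hΩ : volume Ω ≠ ⊤) {u₁ u₂ : ℝ → Vec n → Vec m}
    {Du₁ Du₂ : ℝ → Vec n → Mat m n} (hu₁ : IsWeakSolution A F bc Ω T₀ U₀ u₁ Du₁)
    (hu₂ : IsWeakSolution A F bc Ω T₀ U₀ u₂ Du₂) {K : ℝ}
    (hK : ∀ᵐ t ∂(volume.restrict (Ioo 0 T₀)),
      (∫ x in Ω, ⟪F (u₁ t x) (Du₁ t x) - F (u₂ t x) (Du₂ t x), u₁ t x - u₂ t x⟫_ℝ)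
        - ∫ x in Ω, ⟪A (u₁ t x) (Du₁ t x) - A (u₂ t x) (Du₂ t x), Du₁ t x - Du₂ t x⟫_ℝ
      ≤ K * ∫ x in Ω, ⟪u₁ t x - u₂ t x, u₁ t x - u₂ t x⟫_ℝ) :
    (fun z : ℝ × Vec n => u₁ z.1 z.2) =ᵐ[cylinderMeasure Ω T₀] fun z => u₂ z.1 z.2 := by
  obtain ⟨U₁, f₁, D₁, a₁, hU₁, hf₁, hD₁, ha₁, hae₁, hweak₁⟩ := hu₁.exists_curves
  obtain ⟨U₂, f₂, D₂, a₂, hU₂, hf₂, hD₂, ha₂, hae₂, hweak₂⟩ := hu₂.exists_curves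
  have hW := hU₁.sub hU₂
  have hf := hf₁.sub hf₂
  have hD := hD₁.sub hD₂
  have ha := ha₁.sub ha₂
  have hsub : ∀ᵐ t ∂(volume.restrict (Ioo 0 T₀)),
      ((U₁ - U₂) t =ᵐ[volume.restrict Ω] fun x => u₁ t x - u₂ t x) ∧
      ((f₁ - f₂) t =ᵐ[volume.restrict Ω]
        fun x => F (u₁ t x) (Du₁ t x) - F (u₂ t x) (Du₂ t x)) ∧
      ((D₁ - D₂) t =ᵐ[volume.restrict Ω] fun x => Du₁ t x - Du₂ t x) ∧
      ((a₁ - a₂) t =ᵐ[volume.restrict Ω]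
        fun x => A (u₁ t x) (Du₁ t x) - A (u₂ t x) (Du₂ t x)) := by
    filter_upwards [hae₁, hae₂] with t h1 h2
    exact ⟨(Lp.coeFn_sub _ _).trans (h1.1.sub h2.1), (Lp.coeFn_sub _ _).trans (h1.2.1.sub h2.2.1),
      (Lp.coeFn_sub _ _).trans (h1.2.2.1.sub h2.2.2.1),
      (Lp.coeFn_sub _ _).trans (h1.2.2.2.sub h2.2.2.2)⟩
  -- Cutoffs need not vanish at `0` here: both equations carry the same term `θ(0)∫⟨U₀, v⟩`, which
  -- cancels on subtraction.
  have hid := fun χ => energy_identity (I := Iio T₀) hW hf hD ha (by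
    filter_upwards [hsub, hu₁.mem_energySpace, hu₂.mem_energySpace] with s hs h1 h2 θ k1 k2 k3
    have hV := h1.sub hΩ h2
    have e1 := hweak₁ _ _ hV _ _ hs.1 hs.2.2.1 θ k1 k2 k3
    have e2 := hweak₂ _ _ hV _ _ hs.1 hs.2.2.1 θ k1 k2 k3
    have key : ∀ {E : Type} [NormedAddCommGroup E] [InnerProductSpace ℝ E] (g₁ g₂ : ℝ → E) (v : E)
        (η : ℝ → ℝ), MemLp g₁ 2 (volume.restrict (Ioo 0 T₀)) →
        MemLp g₂ 2 (volume.restrict (Ioo 0 T₀)) → Continuous η → HasCompactSupport η →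
        ∫ t in Ioo 0 T₀, η t * ⟪(g₁ - g₂) t, v⟫_ℝ
          = (∫ t in Ioo 0 T₀, η t * ⟪g₁ t, v⟫_ℝ) - ∫ t in Ioo 0 T₀, η t * ⟪g₂ t, v⟫_ℝ := by
      intro E _ _ g₁ g₂ v η hg₁ hg₂ hη hηs
      have i1 := IntegrableOn.continuous_mul_of_hasCompactSupport
        (hg₁.integrable_real_inner (memLp_const v)) hη hηs
      have i2 := IntegrableOn.continuous_mul_of_hasCompactSupport
        (hg₂.integrable_real_inner (memLp_const v)) hη hηs
      rw [← integral_sub i1 i2]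
      simp only [Pi.sub_apply, inner_sub_left, mul_sub]
    rw [key U₁ U₂ _ _ hU₁ hU₂ (k1.continuous_deriv (by simp)) k2.deriv,
      key a₁ a₂ _ _ ha₁ ha₂ k1.continuous k2, key f₁ f₂ _ _ hf₁ hf₂ k1.continuous k2]
    linarith) (χ := χ)
  have he := hW.integrable_real_inner hW
  have h1 := ha.integrable_real_inner hD
  have h2 := hf.integrable_real_inner hW
  have hKae : ∀ᵐ t ∂(volume.restrict (Ioo 0 T₀)), ⟪(f₁ - f₂) t, (U₁ - U₂) t⟫_ℝ
      - ⟪(a₁ - a₂) t, (D₁ - D₂) t⟫_ℝ ≤ K * ⟪(U₁ - U₂) t, (U₁ - U₂) t⟫_ℝ := by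
    filter_upwards [hK, hsub] with t ht hs
    rwa [L2_inner_eq_integral hs.2.1 hs.1, L2_inner_eq_integral hs.2.2.2 hs.2.2.1,
      L2_inner_eq_integral hs.1 hs.1]
  have hzero := ae_eq_zero_of_energy_inequality (T := T₀) (K := K)
    (e := fun t => ⟪(U₁ - U₂) t, (U₁ - U₂) t⟫_ℝ) he (fun t => real_inner_self_nonneg)
    (fun χ hχ hχs hχT => by
      have := hid χ hχ hχs hχT
      have k1 := IntegrableOn.continuous_mul_of_hasCompactSupport h1
        (hχ.continuous.mul hχ.continuous) hχs.mul_left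
      have k2 := IntegrableOn.continuous_mul_of_hasCompactSupport h2
        (hχ.continuous.mul hχ.continuous) hχs.mul_left
      have k3 := IntegrableOn.continuous_mul_of_hasCompactSupport he
        (hχ.continuous.mul hχ.continuous) hχs.mul_left
      have hmono := integral_mono_ae (k2.sub k1) (k3.const_mul K) (by
        filter_upwards [hKae] with t ht
        have := mul_le_mul_of_nonneg_left ht (mul_self_nonneg (χ t))
        simp only [Pi.sub_apply, Pi.mul_apply] at this ⊢
        linarith)
      have hs1 := integral_sub k2 k1
      simp only [Pi.mul_apply, Pi.sub_apply] at hmono hs1 this ⊢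
      rw [hs1, integral_const_mul] at hmono
      linarith)
  have hm : AEMeasurable (fun z : ℝ × Vec n => ‖u₁ z.1 z.2 - u₂ z.1 z.2‖ₑ ^ 2)
      (cylinderMeasure Ω T₀) := (hu₁.memLp.1.sub hu₂.memLp.1).enorm.pow_const 2
  have hint : ∫⁻ z, ‖u₁ z.1 z.2 - u₂ z.1 z.2‖ₑ ^ 2 ∂(cylinderMeasure Ω T₀) = 0 := by
    rw [cylinderMeasure, lintegral_prod _ hm]
    refine (lintegral_congr_ae ?_).trans lintegral_zero
    filter_upwards [hzero, hsub] with t ht hs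
    rw [lintegral_enorm_sq_eq_ofReal_inner hs.1, ht, ENNReal.ofReal_zero]
  rw [lintegral_eq_zero_iff' hm] at hint
  filter_upwards [hint] with z hz
  simpa [sub_eq_zero] using hz

end Uniqueness

/-! ### The uniqueness theorem -/

theorem lemma5p1 {m n : ℕ} (hn : 2 ≤ n)
    (Ω : Set (Vec n)) (hΩ : IsBoundedSmoothDomain Ω)
    (T₀ : ℝ) (hT₀ : 0 < T₀)
    (bc : BoundaryCondition)
    (A : Vec m → Mat m n → Mat m n) (F : Vec m → Mat m n → Vec m)
    (hA : MonotonicityCondition A) (hAF : LipschitzCondition A F)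
    (U₀ : Vec n → Vec m) (hU₀ : MemLp U₀ 2 (volume.restrict Ω))
    (Cstar p : ℝ) (hp : (n : ℝ) / 2 < p)
    (hbound : ∀ (u : ℝ → Vec n → Vec m) (Du : ℝ → Vec n → Mat m n),
      IsWeakSolution A F bc Ω T₀ U₀ u Du →
        ∀ᵐ t ∂(volume.restrict (Ioo 0 T₀)),
          ∫⁻ x in Ω, ‖Du t x‖ₑ ^ (2 * p) ≤ ENNReal.ofReal Cstar)
    (u₁ u₂ : ℝ → Vec n → Vec m) (Du₁ Du₂ : ℝ → Vec n → Mat m n)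
    (hu₁ : IsWeakSolution A F bc Ω T₀ U₀ u₁ Du₁)
    (hu₂ : IsWeakSolution A F bc Ω T₀ U₀ u₂ Du₂) :
    (fun z : ℝ × Vec n => u₁ z.1 z.2) =ᵐ[cylinderMeasure Ω T₀] fun z => u₂ z.1 z.2 := by
  have hn' : (2 : ℝ) ≤ n := by exact_mod_cast hn
  have hp1 : 1 < p := by linarith
  obtain ⟨lam, hlam, hmono⟩ := hA
  obtain ⟨C, hCc, hC⟩ := hAF
  have hNtop : ENNReal.ofReal Cstar ≠ ⊤ := ENNReal.ofReal_ne_top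
  have hb₁ := hbound u₁ Du₁ hu₁
  have hb₂ := hbound u₂ Du₂ hu₂
  obtain ⟨B₁, hB₁⟩ := hu₁.exists_norm_bound hΩ hT₀ (by linarith) (by linarith) hNtop hb₁
  obtain ⟨B₂, hB₂⟩ := hu₂.exists_norm_bound hΩ hT₀ (by linarith) (by linarith) hNtop hb₂
  -- Both solutions stay in fixed balls, so the continuous coefficient `C` is bounded along them.
  obtain ⟨κ, hκ⟩ := ((isCompact_closedBall (0 : Vec m) B₁).prod
    (isCompact_closedBall (0 : Vec m) B₂)).exists_bound_of_continuousOn hCc.continuousOn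
  set κ' := max κ 0 with hκ'
  have hκ0 : 0 ≤ κ' := le_max_right _ _
  set c := κ' + κ' ^ 2 / lam with hc
  have hc0 : 0 ≤ c := by positivity
  -- Small enough for `c ε ≤ lam / 2`; `c + 1` covers the case `c = 0`.
  set ε := lam / (2 * (c + 1)) with hε
  have hε0 : 0 < ε := by positivity
  have hcε : c * ε ≤ lam / 2 := by
    have : (c + 1) * ε = lam / 2 := by rw [hε]; field_simp
    linarith
  obtain ⟨K, hK, hweight⟩ := hΩ.exists_weighted_bound (m := m) hp1 hp hNtop
    (ε := ENNReal.ofReal ε) (by simpa using hε0)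
  refine hu₁.ae_eq_of_structure hΩ.volume_lt_top.ne hu₂ (K := c * K.toReal + c) ?_
  filter_upwards [hB₁, hB₂, hb₂, hu₁.mem_energySpace, hu₂.mem_energySpace,
    hu₁.memLp_flux.ae_memLp_section, hu₂.memLp_flux.ae_memLp_section,
    hu₁.memLp_reaction.ae_memLp_section, hu₂.memLp_reaction.ae_memLp_section]
    with t h1 h2 h3 h4 h5 h6 h7 h8 h9
  have hW := (h4.sub hΩ.volume_lt_top.ne h5).memW12
  -- The weight is the gradient of the second solution; the bound on the first gradient served only
  -- for boundedness of `u₁`.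
  refine integral_inner_sub_le (h := fun x => ‖Du₂ t x‖) (lam := lam) hW.memLp hW.memLp_grad
    (h8.sub h9) (h6.sub h7) h5.memW12.memLp_grad.1.norm hc0 hε0.le ENNReal.toReal_nonneg hcε ?_ ?_
  · filter_upwards [h1, h2] with x hx1 hx2
    have hCx : C (u₁ t x, u₂ t x) ≤ κ' := by
      refine (le_abs_self _).trans ((hκ _ ⟨?_, ?_⟩).trans (le_max_left _ _))
      · simpa using hx1
      · simpa using hx2
    refine inner_sub_inner_le_of_structure hlam hκ0 hmono ?_ ?_
    · refine (hC (u₁ t x) (u₂ t x) (Du₂ t x) (Du₂ t x)).1.trans ?_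
      gcongr
    · refine (hC (u₁ t x) (u₂ t x) (Du₁ t x) (Du₂ t x)).2.trans ?_
      gcongr
  · rw [ENNReal.ofReal_toReal hK]
    simp only [enorm_norm]
    exact hweight _ _ _ hW h5.memW12.memLp_grad.1.enorm h3
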